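/- Definitions. A check stack pushdown automaton (cspda) with input alphabet $A$ is a nondeterministic machine with finitely many states, a one-way input tape, a check stack over a finite alphabet $\Delta$ and a pushdown stack over a finite alphabet $\Gamma$, where both alphabets contain $A$ and a padding symbol. In the first stage a finite state automaton with a single initial state writes a word to the check stack, without reading input or using the pushdown stack. In the second stage the check stack is fixed; the head stands at the top of the pushdown stack and at the same height on the check stack, and sees the two symbols there (or that the pushdown stack is empty). According to its state and what it sees, the machine may read an input letter or no input, pop the symbol it sees on the pushdown stack (if there is one), push a word onto the pushdown stack, and change state. An input word is accepted if, after all of it has been read, an accepting state is entered; $L(\mathcal M)$ is the set of accepted words. A fail state is a non-accepting state from which no path in the transition graph leads to an accepting state. Each second-stage state is assumed to be either a reading state (allowing only moves that read a letter) or a non-reading state (allowing only moves that read nothing), and there is at most one fail state; it is non-reading and has no outgoing moves. An entry configuration is a configuration at the beginning of the second stage. For an entry configuration $C$ and a word $w$, $C^w$ denotes the configuration in which the machine, started in $C$, enters its first reading state after reading all of $w$; $C^w$ fails if the machine enters the fail state without reaching such a state. The cspda $\mathcal M$ is special if in its second stage: (0) there is no infinite path of non-reading moves, and every path of non-reading moves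 leads eventually to a reading state or the fail state; (1) every entry configuration has empty pushdown stack and a reading state, and the operation is deterministic (at most one move is possible at any time, and in a reading state every letter can be read); (2) the head never moves above the top of the check stack (the machine fails instead); (3) for every entry configuration $C$ and all $u,v\in A^*$ with $v\notin L(\mathcal M)$, either $C^{uv}=C^u$ or $C^{uv}$ fails. A finitely generated group $G$ is a special co-ET0L group if, for some finite inverse-closed generating set $A$ of $G$, the co-word problem $\{w\in A^* : w\ne_G 1\}$ is $L(\mathcal M)$ for a special cspda $\mathcal M$. For integers $n\ge 2$, $r\ge 1$ let $Q$ and $\Sigma$ be disjoint sets with $|Q|=r$, $|\Sigma|=n$, and let $\Omega$ be the set of infinite strings $q\sigma_1\sigma_2\cdots$ with $q\in Q$, $\sigma_i\in\Sigma$. A finite complete antichain is a finite set $B\subset Q\Sigma^*$ such that each $\omega\in\Omega$ has precisely one element of $B$ as a prefix. A bijection $\varphi:B\to C$ between finite complete antichains induces the permutation $b\omega'\mapsto \varphi(b)\omega'$ of $\Omega$ ($b\in B$). The Higman--Thompson group $G_{n,r}$ is the group of all permutations of $\Omega$ so induced. Thompson's groups $F\le T\le V=G_{2,1}$ consist of the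 elements of $G_{2,1}$ that preserve, respectively, the lexicographic order on $\Omega$ and the cyclic order on $\Omega$ that comes from the lexicographic order. Theorem. For all integers $n\ge 2$ and $r\ge 1$, the Higman--Thompson group $G_{n,r}$ is a special co-ET0L group. Moreover, Thompson's groups $F$ and $T$ are special co-ET0L groups. -/

import Mathlib

universe u

/-! ## Check stack pushdown automata -/

/-- A check stack pushdown automaton (cspda) with input alphabet `A`.

In the first stage (the initialisation) a nondeterministic finite state automaton, with state set
`Init` and a single initial state, writes a word to the check stack; it neither reads input nor
touches the pushdown stack.  The second stage begins with a move into a state in `State`.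

In the second stage the head stands at the top of the pushdown stack, and at the same height on
the check stack.  It sees `none` if the pushdown stack is empty, so that the head is at the bottom
of both stacks; otherwise it sees `some (d, g)`, where `g` is the top symbol of the pushdown stack
and `d` is the symbol at the same height of the check stack (`d = none` if the head is above the
top of the check stack).  For `(q', w) ∈ trans q x v`, the automaton in state `q` that sees `v`
may consume `x` (an input letter, or nothing when `x = none`), pop the top symbol of the pushdown
stack (if it is not empty), push the word `w` (its last letter first), and enter state `q'`. -/
structure CSPDA (A : Type u) where
  /-- states of the first stage -/
  Init : Type
  /-- states of the second stage -/
  State : Type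
  /-- check stack alphabet -/
  Check : Type
  /-- pushdown stack alphabet -/
  Push : Type
  finite_Init : Finite Init
  finite_State : Finite State
  finite_Check : Finite Check
  finite_Push : Finite Push
  /-- the check stack alphabet contains the input letters and a padding symbol (`none`) -/
  checkLetter : Option A ↪ Check
  /-- the pushdown stack alphabet contains the input letters and a padding symbol (`none`) -/
  pushLetter : Option A ↪ Push
  /-- the initial state -/
  start : Init
  /-- moves of the first stage that write nothing -/
  silentMove : Init → Set Init
  /-- moves of the first stage that push one symbol to the check stack -/
  writeMove : Init → Set (Check × Init)
  /-- moves that end the first stage -/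
  enter : Init → Set State
  /-- moves of the second stage -/
  trans : State → Option A → Option (Option Check × Push) → Finset (State × List Push)
  /-- accepting states -/
  accept : Set State
  /-- the states designated as reading states; all others are non-reading states -/
  reading : Set State

namespace CSPDA

variable {A : Type u} (M : CSPDA A)

/-- `M.Writes s c`: the first stage can lead from the initial state with empty check stack to
state `s` with check stack `c` (listed from bottom to top). -/
inductive Writes : M.Init → List M.Check → Prop
  | start : Writes M.start []
  | silent {s t : M.Init} {c : List M.Check} :
      Writes s c → t ∈ M.silentMove s → Writes t c
  | write {s t : M.Init} {c : List M.Check} {d : M.Check} :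
      Writes s c → (d, t) ∈ M.writeMove s → Writes t (c ++ [d])

/-- A configuration of the second stage. -/
@[ext]
structure Config where
  state : M.State
  /-- contents of the check stack, listed from bottom to top -/
  check : List M.Check
  /-- contents of the pushdown stack, listed from top to bottom -/
  push : List M.Push

variable {M}

/-- What the head sees. -/
def Config.view (C : M.Config) : Option (Option M.Check × M.Push) :=
  match C.push with
  | [] => none
  | g :: p => some (C.check[p.length]?, g)

variable (M)

/-- A single move of the second stage, consuming a letter (`some a`) or nothing (`none`). -/
inductive Step : M.Config → Option A → M.Config → Prop
  | move {C : M.Config} {x : Option A} {q : M.State} {w : List M.Push} :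
      (q, w) ∈ M.trans C.state x C.view → Step C x ⟨q, C.check, w ++ C.push.tail⟩

/-- `M.Run C w D`: some finite sequence of moves of the second stage leads from `C` to `D` and
consumes exactly the word `w`. -/
inductive Run : M.Config → List A → M.Config → Prop
  | refl (C : M.Config) : Run C [] C
  | silent {C D E : M.Config} {w : List A} : M.Step C none D → Run D w E → Run C w E
  | read {C D E : M.Config} {a : A} {w : List A} :
      M.Step C (some a) D → Run D w E → Run C (a :: w) E

/-- The entry configurations, at the beginning of the second stage. -/
def IsEntry (C : M.Config) : Prop :=
  C.push = [] ∧ ∃ s, M.Writes s C.check ∧ C.state ∈ M.enter s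

/-- The configurations that occur during the second stage. -/
def Reachable (D : M.Config) : Prop :=
  ∃ C w, M.IsEntry C ∧ M.Run C w D

/-- The language accepted: after reading all of the input, an accepting state is entered. -/
def language : Language A :=
  {w | ∃ C D, M.IsEntry C ∧ M.Run C w D ∧ D.state ∈ M.accept}

/-- There is a move from `q` to `q'` in the transition graph of the second stage. -/
def Edge (q q' : M.State) : Prop :=
  ∃ x v w, (q', w) ∈ M.trans q x v

/-- A fail state: non-accepting, and no path leads from it to an accepting state. -/
def IsFail (q : M.State) : Prop :=
  ∀ q', Relation.ReflTransGen M.Edge q q' → q' ∉ M.accept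

/-- `C ^ w = D`: the automaton enters its first reading state after reading all of `w` in
configuration `D`.  (No move that consumes nothing is possible from a reading state of an
automaton in normal form, so the first such configuration is the only one.) -/
def Result (C : M.Config) (w : List A) (D : M.Config) : Prop :=
  M.Run C w D ∧ D.state ∈ M.reading

/-- `C ^ w` fails: the fail state is entered while processing `w`. -/
def Fails (C : M.Config) (w : List A) : Prop :=
  ∃ w' D, w' <+: w ∧ M.Run C w' D ∧ M.IsFail D.state

/-- The standing assumptions: reading states allow only reading moves and the other states only
non-reading moves; there is at most one fail state, it is a non-reading state, and it has no
outgoing moves. -/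
structure Normal : Prop where
  of_reading : ∀ q ∈ M.reading, ∀ v, M.trans q none v = ∅
  of_not_reading : ∀ q ∉ M.reading, ∀ a v, M.trans q (some a) v = ∅
  fail_unique : ∀ q q', M.IsFail q → M.IsFail q' → q = q'
  fail_not_reading : ∀ q, M.IsFail q → q ∉ M.reading
  fail_stop : ∀ q, M.IsFail q → ∀ x v, M.trans q x v = ∅

/-- Special cspda. -/
structure IsSpecial : Prop where
  normal : M.Normal
  /-- (0), first part: there is no infinite path of non-reading moves. -/
  no_infinite : ¬ ∃ f : ℕ → M.Config, M.Reachable (f 0) ∧ ∀ i, M.Step (f i) none (f (i + 1))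
  /-- (0), second part: a path of non-reading moves ends only in a reading or fail state. -/
  progress : ∀ D, M.Reachable D → D.state ∉ M.reading → ¬ M.IsFail D.state →
    ∃ D', M.Step D none D'
  /-- (1), first part: the second stage begins in a reading state (with empty pushdown stack, as
  holds for every entry configuration). -/
  entry_reading : ∀ s, ∀ q ∈ M.enter s, q ∈ M.reading
  /-- (1), second part: the second stage is deterministic: at most one move is possible ... -/
  deterministic : ∀ q x v, (M.trans q x v : Set (M.State × List M.Push)).Subsingleton
  /-- ... and every letter can be read in a reading configuration (perhaps leading to failure). -/
  complete : ∀ D, M.Reachable D → D.state ∈ M.reading → ∀ a, ∃ D', M.Step D (some a) D'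
  /-- (2): the head never moves above the top of the check stack.  (So, by `progress` and
  `complete`, the automaton has to make another move, such as one into the fail state, where a
  push would take the head above the top.) -/
  bounded : ∀ D, M.Reachable D → D.push.length ≤ D.check.length
  /-- (3): for `v` not in the language, either `C ^ (u v) = C ^ u` or `C ^ (u v)` fails. -/
  ignores : ∀ C, M.IsEntry C → ∀ u v, v ∉ M.language →
    (∃ D, M.Result C u D ∧ M.Result C (u ++ v) D) ∨ M.Fails C (u ++ v)

end CSPDA

/-- A special ET0L language: one that is accepted by a special cspda. -/
def IsSpecialET0L {A : Type u} (L : Language A) : Prop :=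
  ∃ M : CSPDA A, M.IsSpecial ∧ M.language = L

/-- The co-word problem of a group with respect to a set `A` of elements: the words over `A` that
do not represent the identity. -/
def coWordProblem {G : Type u} [Group G] (A : Set G) : Language A :=
  {w | (w.map (fun a : A => (a : G))).prod ≠ 1}

/-- Special co-ET0L groups: for some finite inverse-closed generating set, the co-word problem is
accepted by a special cspda. -/
def IsSpecialCoET0L (G : Type u) [Group G] : Prop :=
  ∃ A : Set G, A.Finite ∧ (∀ a ∈ A, a⁻¹ ∈ A) ∧ Subgroup.closure A = ⊤ ∧
    IsSpecialET0L (coWordProblem A)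

/-! ## Higman-Thompson groups -/

namespace HigmanThompson

/-- The infinite strings `q σ₁ σ₂ ⋯` with `q` in an alphabet of size `r` and every `σᵢ` in an
alphabet of size `n`. -/
abbrev Point (n r : ℕ) : Type := Fin r × Stream' (Fin n)

/-- The finite strings `q σ₁ ⋯ σₖ`, `k ≥ 0`, the non-empty prefixes of points. -/
abbrev Word (n r : ℕ) : Type := Fin r × List (Fin n)

variable {n r : ℕ}

/-- The point `b s` for a word `b` and an infinite string `s`. -/
def extend (b : Word n r) (s : Stream' (Fin n)) : Point n r := (b.1, b.2 ++ₛ s)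

/-- A finite set of words such that every point has precisely one of them as a prefix. -/
def IsCompleteAntichain (B : Finset (Word n r)) : Prop :=
  ∀ p : Point n r, ∃! b, b ∈ B ∧ ∃ s, p = extend b s

/-- The permutation `f` of the set of points is induced by a bijection between two finite complete
antichains. -/
def IsPrefixReplacement (f : Equiv.Perm (Point n r)) : Prop :=
  ∃ (B C : Finset (Word n r)), IsCompleteAntichain B ∧ IsCompleteAntichain C ∧
    ∃ φ : B ≃ C, ∀ (b : B) (s : Stream' (Fin n)),
      f (extend (b : Word n r) s) = extend (φ b : Word n r) s

theorem extend_extend (i : Fin r) (l m : List (Fin n)) (s : Stream' (Fin n)) :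
    extend (i, l) (m ++ₛ s) = extend (i, l ++ m) s := by
  simp [extend]

theorem extend_take_drop (p : Point n r) (N : ℕ) :
    extend (p.1, p.2.take N) (p.2.drop N) = p := by
  simp [extend, Stream'.append_take_drop]

theorem eq_of_extend_eq {b c : Word n r} {s t : Stream' (Fin n)}
    (hl : b.2.length = c.2.length) (h : extend b s = extend c t) : b = c := by
  obtain ⟨i, l⟩ := b
  obtain ⟨j, m⟩ := c
  simp only [extend, Prod.mk.injEq] at h hl ⊢
  refine ⟨h.1, ?_⟩
  have h2 := congrArg (Stream'.take l.length) h.2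
  rw [Stream'.take_append_of_le_length (h := le_rfl)] at h2
  rw [hl, Stream'.take_append_of_le_length (h := le_rfl), ← hl] at h2
  rw [List.take_length, hl, List.take_length] at h2
  exact h2

theorem prefix_of_extend_eq {b : Word n r} {i : Fin r} {m : List (Fin n)}
    {s t : Stream' (Fin n)} (hl : b.2.length ≤ m.length) (h : extend b s = extend (i, m) t) :
    ∃ m', (i, m) = (b.1, b.2 ++ m') := by
  have h1 : extend b s = extend (i, m.take b.2.length) (m.drop b.2.length ++ₛ t) := by
    rw [extend_extend, List.take_append_drop, h]
  have h2 := eq_of_extend_eq (by simpa using hl) h1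
  refine ⟨m.drop b.2.length, ?_⟩
  have h3 : b.1 = i := by rw [h2]
  have h4 : b.2 = m.take b.2.length := congrArg Prod.snd h2
  rw [h3, Prod.mk.injEq]
  refine ⟨rfl, ?_⟩
  calc m = m.take b.2.length ++ m.drop b.2.length := (List.take_append_drop _ _).symm
    _ = b.2 ++ m.drop b.2.length := by rw [← h4]

theorem isPrefixReplacement_iff (f : Equiv.Perm (Point n r)) :
    IsPrefixReplacement f ↔ ∃ N, 0 < N ∧ ∀ x : Word n r, x.2.length = N →
      ∃ y : Word n r, ∀ s, f (extend x s) = extend y s := by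
  classical
  constructor
  · rintro ⟨B, C, hB, -, φ, hφ⟩
    refine ⟨B.sup (fun b => b.2.length) + 1, by omega, ?_⟩
    rintro ⟨i, m⟩ hx
    simp only at hx
    obtain ⟨a⟩ : Nonempty (Fin n) := by
      cases m with
      | nil => simp at hx
      | cons a _ => exact ⟨a⟩
    obtain ⟨b, ⟨hb, s, hs⟩, -⟩ := hB (extend (i, m) (Stream'.const a))
    have hle : b.2.length ≤ m.length := by
      have := Finset.le_sup (f := fun b : Word n r => b.2.length) hb
      omega
    obtain ⟨m', hm'⟩ := prefix_of_extend_eq hle hs.symm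
    refine ⟨((φ ⟨b, hb⟩ : Word n r).1, (φ ⟨b, hb⟩ : Word n r).2 ++ m'), fun t => ?_⟩
    rw [hm', ← extend_extend, ← extend_extend]
    exact hφ ⟨b, hb⟩ _
  · rintro ⟨N, hN, h⟩
    have hfin : {x : Word n r | x.2.length = N}.Finite := by
      refine ((Set.finite_univ (α := Fin r)).prod (List.finite_length_eq (Fin n) N)).subset ?_
      intro x hx
      exact ⟨Set.mem_univ _, hx⟩
    choose! y hy using h
    set B : Finset (Word n r) := hfin.toFinset with hBdef
    have hmem : ∀ x, x ∈ B ↔ x.2.length = N := by simp [hBdef]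
    have hinj : Set.InjOn y B := by
      intro x hx x' hx' hxx
      have hx := (hmem x).1 hx
      have hx' := (hmem x').1 hx'
      obtain ⟨a⟩ : Nonempty (Fin n) := by
        rcases hl : x.2 with _ | ⟨a, _⟩
        · rw [hl] at hx; simp at hx; omega
        · exact ⟨a⟩
      have : f (extend x (Stream'.const a)) = f (extend x' (Stream'.const a)) := by
        rw [hy x hx, hy x' hx', hxx]
      exact eq_of_extend_eq (hx.trans hx'.symm) (f.injective this)
    refine ⟨B, B.image y, ?_, ?_, ?_⟩
    · intro p
      refine ⟨(p.1, p.2.take N), ⟨by simp [hmem], _, (extend_take_drop p N).symm⟩, ?_⟩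
      rintro c ⟨hc, s, hs⟩
      refine eq_of_extend_eq (s := s) (t := p.2.drop N) ?_ ?_
      · simpa using (hmem c).1 hc
      · rw [extend_take_drop, hs]
    · intro p
      have hq := extend_take_drop (f.symm p) N
      set x : Word n r := ((f.symm p).1, (f.symm p).2.take N) with hx
      have hxN : x.2.length = N := by simp [hx]
      refine ⟨y x, ⟨Finset.mem_image_of_mem _ ((hmem x).2 hxN),
        (f.symm p).2.drop N, ?_⟩, ?_⟩
      · rw [← hy x hxN, hq, Equiv.apply_symm_apply]
      · rintro c ⟨hc, s, hs⟩
        obtain ⟨x', hx', rfl⟩ := Finset.mem_image.1 hc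
        have hx' := (hmem x').1 hx'
        congr 1
        rw [← hy x' hx'] at hs
        refine eq_of_extend_eq (s := s) (t := (f.symm p).2.drop N) (hx'.trans hxN.symm) ?_
        rw [hq, hs, Equiv.symm_apply_apply]
    · refine ⟨Equiv.ofBijective
        (fun b => ⟨y b, Finset.mem_image_of_mem _ b.2⟩) ⟨?_, ?_⟩, ?_⟩
      · intro b b' hbb
        exact Subtype.ext (hinj b.2 b'.2 (congrArg Subtype.val hbb))
      · rintro ⟨c, hc⟩
        obtain ⟨x, hx, rfl⟩ := Finset.mem_image.1 hc
        exact ⟨⟨x, hx⟩, rfl⟩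
      · intro b s
        exact hy b ((hmem b).1 b.2) s

end HigmanThompson

open HigmanThompson in
/-- The Higman-Thompson group `G_{n,r}`: all permutations of the set of points that are induced by
bijections between finite complete antichains. -/
def higmanThompsonGroup (n r : ℕ) : Subgroup (Equiv.Perm (Point n r)) where
  carrier := {f | IsPrefixReplacement f}
  one_mem' := (isPrefixReplacement_iff _).2 ⟨1, one_pos, fun x _ => ⟨x, fun _ => rfl⟩⟩
  mul_mem' := by
    intro f g hf hg
    obtain ⟨N, hN, hf⟩ := (isPrefixReplacement_iff f).1 hf
    obtain ⟨K, hK, hg⟩ := (isPrefixReplacement_iff g).1 hg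
    refine (isPrefixReplacement_iff _).2 ⟨K + N, by omega, ?_⟩
    rintro ⟨i, l⟩ hl
    simp only at hl
    obtain ⟨y, hy⟩ := hg (i, l.take K) (by simp; omega)
    set m := y.2 ++ l.drop K with hm
    have hmlen : N ≤ m.length := by simp [hm]; omega
    obtain ⟨z, hz⟩ := hf (y.1, m.take N) (by simpa using hmlen)
    refine ⟨(z.1, z.2 ++ m.drop N), fun s => ?_⟩
    rw [Equiv.Perm.mul_apply]
    calc f (g (extend (i, l) s))
        = f (g (extend (i, l.take K) (l.drop K ++ₛ s))) := by
          rw [extend_extend, List.take_append_drop]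
      _ = f (extend (y.1, m) s) := by rw [hy, hm, ← extend_extend]
      _ = f (extend (y.1, m.take N) (m.drop N ++ₛ s)) := by
          rw [extend_extend, List.take_append_drop]
      _ = extend (z.1, z.2 ++ m.drop N) s := by rw [hz, ← extend_extend]
  inv_mem' := by
    rintro f ⟨B, C, hB, hC, φ, hφ⟩
    refine ⟨C, B, hC, hB, φ.symm, fun c s => ?_⟩
    rw [Equiv.Perm.inv_eq_iff_eq, hφ, Equiv.apply_symm_apply]

/-! ## Thompson's groups `F` and `T` -/

namespace HigmanThompson

/-- The lexicographic order on infinite binary strings (the first letter `q` is constant). -/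
def LexLT (p q : Point 2 1) : Prop :=
  ∃ k, (∀ j < k, p.2.get j = q.2.get j) ∧ p.2.get k < q.2.get k

/-- The cyclic order on infinite binary strings that comes from the lexicographic order. -/
def CyclicLT (p q t : Point 2 1) : Prop :=
  (LexLT p q ∧ LexLT q t) ∨ (LexLT q t ∧ LexLT t p) ∨ (LexLT t p ∧ LexLT p q)

end HigmanThompson

open HigmanThompson in
/-- Thompson's group `F`: the elements of `V = G_{2,1}` that preserve the lexicographic order. -/
def thompsonF : Subgroup (Equiv.Perm (Point 2 1)) where
  carrier := {f | f ∈ higmanThompsonGroup 2 1 ∧ ∀ p q, LexLT (f p) (f q) ↔ LexLT p q}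
  one_mem' := ⟨one_mem _, fun _ _ => Iff.rfl⟩
  mul_mem' := fun hf hg => ⟨mul_mem hf.1 hg.1, fun _ _ => (hf.2 _ _).trans (hg.2 _ _)⟩
  inv_mem' := fun {f} hf => ⟨inv_mem hf.1, fun p q => by
    simpa using (hf.2 (f⁻¹ p) (f⁻¹ q)).symm⟩

open HigmanThompson in
/-- Thompson's group `T`: the elements of `V = G_{2,1}` that preserve the cyclic order. -/
def thompsonT : Subgroup (Equiv.Perm (Point 2 1)) where
  carrier := {f | f ∈ higmanThompsonGroup 2 1 ∧
    ∀ p q t, CyclicLT (f p) (f q) (f t) ↔ CyclicLT p q t}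
  one_mem' := ⟨one_mem _, fun _ _ _ => Iff.rfl⟩
  mul_mem' := fun hf hg => ⟨mul_mem hf.1 hg.1, fun _ _ _ => (hf.2 _ _ _).trans (hg.2 _ _ _)⟩
  inv_mem' := fun {f} hf => ⟨inv_mem hf.1, fun p q t => by
    simpa using (hf.2 (f⁻¹ p) (f⁻¹ q) (f⁻¹ t)).symm⟩

/-! ## Runs of check stack pushdown automata -/

namespace CSPDA

variable {A : Type u} {M : CSPDA A}

/-! A prefix replacement can be applied by a machine with a bounded buffer, and finitely many of
them act on prefixes of one common length (`exists_prefixRules`). The first stage guesses the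
beginning `q₀`, `x ++ [z]` of a point and writes `x ++ [z]` to the check stack, first letter at the
bottom. After some generators have acted, the string begins with a letter `q`, kept in the state,
and continues with `p` and then with `x ++ [z]` without its first `j` letters. The pushdown stack
stores this as `j` markers at the bottom and `p` above them, so that each marker stands beside the
check letter that it removes. To apply a generator, the machine collects a window of letters,
popping `p` and then pushing markers and reading the check letters beside them. It chooses the
replacement, cancels its final letters against the last removed check letters, and writes the rest.
If there is no room, it fails.

Because of the cancellation, `(q, p, j)` is a normal form: it is determined by the permutation
applied so far and by the guessed prefix (`Tracks.unique`). A word that acts trivially therefore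
restores the configuration or causes failure, which is condition (3). The machine accepts when the
normal form differs from the initial one. A nontrivial permutation moves some point, and a long
enough prefix of that point leads to acceptance, since each input letter raises the stack by a
bounded amount (`word_run`). So every finitely generated subgroup of `G_{n,r}` is special co-ET0L
(`isSpecialCoET0L_of_closure`).

What remains is finite generation. Every finite complete antichain arises from the roots by
expansions. For `G_{n,r}`, swaps of two cones realise all reorderings and bring each antichain to a
standard one of the same size; conjugation shortens the swapped words to length at most three
(`closure_shortSwaps`). An element of `F` keeps the order of the words, and two rotations bring each
antichain to a vine (`closure_eq_thompsonF`). An element of `T` can be corrected by known generators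
until it fixes the least point, and then it lies in `F` (`closure_eq_thompsonT`). -/

theorem Run.trans {C D E : M.Config} {v w : List A} (h : M.Run C v D) (h' : M.Run D w E) :
    M.Run C (v ++ w) E := by
  induction h with
  | refl => exact h'
  | silent h₁ _ ih => exact .silent h₁ (ih h')
  | read h₁ _ ih => exact .read h₁ (ih h')

theorem Run.single {C D : M.Config} (h : M.Step C none D) : M.Run C [] D := .silent h (.refl _)

theorem Reachable.induction {P : M.Config → Prop} (h₀ : ∀ C, M.IsEntry C → P C)
    (h₁ : ∀ C x D, M.Step C x D → P C → P D) {D : M.Config} (h : M.Reachable D) : P D := by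
  obtain ⟨C, w, hC, hr⟩ := h
  have := h₀ C hC
  clear hC
  induction hr with
  | refl => exact this
  | silent h _ ih => exact ih (h₁ _ _ _ h this)
  | read h _ ih => exact ih (h₁ _ _ _ h this)

theorem Step.unique (hd : ∀ q x v, (M.trans q x v : Set (M.State × List M.Push)).Subsingleton)
    {C D E : M.Config} {x : Option A} (h : M.Step C x D) (h' : M.Step C x E) : D = E := by
  cases h with
  | move h =>
    cases h' with
    | move h' =>
      have := hd _ _ _ h h'
      simp only [Prod.mk.injEq] at this
      rw [this.1, this.2]

theorem Normal.not_silent_of_read (hN : M.Normal) {C D E : M.Config} {a : A}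
    (h : M.Step C (some a) D) : ¬ M.Step C none E := by
  rintro ⟨h'⟩
  obtain ⟨h⟩ := h
  by_cases hC : C.state ∈ M.reading
  · simp [hN.of_reading _ hC] at h'
  · simp [hN.of_not_reading _ hC] at h

/-- Two runs of a deterministic automaton on compatible inputs: one continues the other. -/
theorem Run.confluent (hN : M.Normal)
    (hd : ∀ q x v, (M.trans q x v : Set (M.State × List M.Push)).Subsingleton)
    {C D E : M.Config} {v w : List A} (h : M.Run C v D) (h' : M.Run C (v ++ w) E) :
    M.Run D w E ∨ w = [] ∧ M.Run E [] D := by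
  induction h with
  | refl => exact .inl h'
  | @silent C C₁ D v h₁ h₂ ih =>
    generalize hvw : v ++ w = vw at h'
    cases h' with
    | refl =>
      obtain ⟨rfl, rfl⟩ := List.append_eq_nil_iff.1 hvw
      exact .inr ⟨rfl, .silent h₁ h₂⟩
    | silent h₃ h₄ =>
      obtain rfl := h₁.unique hd h₃
      subst hvw
      exact ih h₄
    | read h₃ h₄ => exact (hN.not_silent_of_read h₃ h₁).elim
  | @read C C₁ D a v h₁ h₂ ih =>
    generalize hvw : a :: v ++ w = vw at h'
    cases h' with
    | refl => simp at hvw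
    | silent h₃ h₄ => exact (hN.not_silent_of_read h₁ h₃).elim
    | read h₃ h₄ =>
      simp only [List.cons_append, List.cons.injEq] at hvw
      obtain ⟨rfl, rfl⟩ := hvw
      obtain rfl := h₁.unique hd h₃
      exact ih h₄

theorem Run.eq_of_stopped {C D : M.Config} (h : M.Run C [] D) (hC : ∀ E, ¬ M.Step C none E) :
    D = C := by
  cases h with
  | refl => rfl
  | silent h _ => exact (hC _ h).elim

theorem Normal.not_silent_of_reading (hN : M.Normal) {C D : M.Config}
    (hC : C.state ∈ M.reading) : ¬ M.Step C none D := by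
  rintro ⟨h⟩
  simp [hN.of_reading _ hC] at h

theorem Normal.not_step_of_isFail (hN : M.Normal) {C D : M.Config} {x : Option A}
    (hC : M.IsFail C.state) : ¬ M.Step C x D := by
  rintro ⟨h⟩
  rw [hN.fail_stop _ hC] at h
  exact Finset.notMem_empty _ h

/-- By confluence one run continues the other without input, and a reading state has no silent move.
This makes `C ^ w` well defined. -/
theorem Result.unique (hN : M.Normal)
    (hd : ∀ q x v, (M.trans q x v : Set (M.State × List M.Push)).Subsingleton)
    {C D E : M.Config} {w : List A} (h : M.Result C w D) (h' : M.Result C w E) : D = E := by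
  have h₁ : M.Run C (w ++ []) E := by simpa using h'.1
  rcases h.1.confluent hN hd h₁ with h₂ | ⟨-, h₂⟩
  · exact (h₂.eq_of_stopped fun _ => hN.not_silent_of_reading h.2).symm
  · exact h₂.eq_of_stopped fun _ => hN.not_silent_of_reading h'.2

/-- The failing run is comparable with the successful one. Neither a fail state nor, without input,
a reading state can be left, so the two final configurations would coincide. -/
theorem Result.not_fails (hN : M.Normal)
    (hd : ∀ q x v, (M.trans q x v : Set (M.State × List M.Push)).Subsingleton)
    {C D : M.Config} {w : List A} (h : M.Result C w D) : ¬ M.Fails C w := by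
  rintro ⟨v, E, ⟨t, rfl⟩, hE, hf⟩
  rcases hE.confluent hN hd h.1 with h₂ | ⟨-, h₂⟩
  · have : D = E := by
      cases h₂ with
      | refl => rfl
      | silent h _ => exact (hN.not_step_of_isFail hf h).elim
      | read h' _ => exact (hN.not_step_of_isFail hf h').elim
    subst this
    exact hN.fail_not_reading _ hf h.2
  · obtain rfl := h₂.eq_of_stopped fun _ => hN.not_silent_of_reading h.2
    exact hN.fail_not_reading _ hf h.2

theorem Fails.append {C : M.Config} {w : List A} (h : M.Fails C w) (v : List A) :
    M.Fails C (w ++ v) := by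
  obtain ⟨w', D, hw, h⟩ := h
  exact ⟨w', D, hw.trans (List.prefix_append _ _), h⟩

end CSPDA

/-! ## An automaton that applies prefix replacements -/

/-- Rules that replace prefixes of a fixed length `window` of finite strings over `Fin n`
(preceded by a letter of `Fin r`) by words of bounded length, one rule for each letter of `A`. -/
structure PrefixRules (A : Type) (n r : ℕ) where
  window : ℕ
  bound : ℕ
  window_le : window ≤ bound
  rule : A → Fin r → List (Fin n) → Fin r × List (Fin n)
  rule_le : ∀ a q u, u.length = window → (rule a q u).2.length ≤ bound

namespace PrefixRules

/-- Words of length at most `m`. -/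
abbrev Buffer (n m : ℕ) : Type := {l : List (Fin n) // l.length ≤ m}

/-- The longest prefix of a word that fits into a buffer. -/
def trunc {n : ℕ} (m : ℕ) (l : List (Fin n)) : Buffer n m := ⟨l.take m, by simp⟩

/-- Truncation spares the transition table all length proofs. In the runs that matter the words fit,
and nothing is cut off. -/
theorem trunc_val {n m : ℕ} {l : List (Fin n)} (h : l.length ≤ m) : (trunc m l).1 = l := by
  simpa [trunc] using h

@[simp] theorem length_trunc {n m : ℕ} (l : List (Fin n)) :
    (trunc m l).1.length = min m l.length := by
  simp [trunc]

/-- The states of the second stage: the first letters of the original and the current string, and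
the phase of the replacement. -/
inductive State (A : Type) (n r m : ℕ) : Type
  /-- between two replacements; `b` tells whether the pushdown stack is non-empty -/
  | read (q₀ q : Fin r) (b : Bool)
  /-- removing the prefix `u` from the current string -/
  | pull (q₀ q : Fin r) (a : A) (u : Buffer n m)
  /-- the next letter of `u` is the current letter of the check stack -/
  | absorb (q₀ q : Fin r) (a : A) (u : Buffer n m)
  /-- cancelling final letters of `y` that agree with those removed from the check stack -/
  | cancel (q₀ q : Fin r) (y : Buffer n m)
  /-- writing `y` to the pushdown stack -/
  | write (q₀ q : Fin r) (y : Buffer n m)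
  | fail

/-- The flag tells the top letter of the check stack. The summand `Option A` only supplies the
required input letters and padding symbol; it is never written. -/
abbrev CheckSym (A : Type) (n : ℕ) : Type := (Fin n × Bool) ⊕ Option A

abbrev PushSym (A : Type) (n : ℕ) : Type := Option (Fin n) ⊕ Option A

abbrev View (A : Type) (n : ℕ) : Type := Option (Option (CheckSym A n) × PushSym A n)

variable {A : Type} {n r : ℕ}

/-- The symbol on the pushdown stack for a letter that was removed from the check stack. -/
def marker : PushSym A n := .inl none

def letter (τ : Fin n) : PushSym A n := .inl (some τ)

/-- The word to be pushed in order to leave the pushdown stack unchanged. -/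
def keep : View A n → List (PushSym A n)
  | none => []
  | some (_, g) => [g]

variable (R : PrefixRules A n r)

/-- An empty stack or a marker on top means that `p` is used up. The next letter is then on the
check stack, one place higher, and a new marker takes the head there unless the flag shows that
there is no such place. -/
def nextPull (q₀ q : Fin r) (a : A) (u : Buffer n R.bound) :
    View A n → State A n r R.bound × List (PushSym A n)
  | none => (.absorb q₀ q a u, [marker])
  | some (_, .inl (some τ)) => (.pull q₀ q a (trunc _ (u.1 ++ [τ])), [])
  | some (some (.inl (_, false)), .inl none) => (.absorb q₀ q a u, [marker, marker])
  | some (_, g) => (.fail, [g])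

def nextAbsorb (q₀ q : Fin r) (a : A) (u : Buffer n R.bound) :
    View A n → State A n r R.bound × List (PushSym A n)
  | some (some (.inl (σ, _)), g) => (.pull q₀ q a (trunc _ (u.1 ++ [σ])), [g])
  | v => (.fail, keep v)

/-- With a marker on top, the last letter of `y` would directly follow the removed letters. If it
equals the last of these, popping the marker restores that letter and `y` need not contain it. -/
def nextCancel (q₀ q : Fin r) (y : Buffer n R.bound) :
    View A n → State A n r R.bound × List (PushSym A n)
  | some (some (.inl (σ, b)), .inl none) =>
      if y.1.getLast? = some σ then (.cancel q₀ q (trunc _ y.1.dropLast), [])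
      else (.write q₀ q y, keep (some (some (.inl (σ, b)), .inl none)))
  | v => (.write q₀ q y, keep v)

def nextWrite (q₀ q : Fin r) (y : Buffer n R.bound) (τ : Fin n) :
    View A n → State A n r R.bound × List (PushSym A n)
  | none => (.write q₀ q (trunc _ y.1.dropLast), [letter τ])
  | some (some (.inl (_, false)), g) => (.write q₀ q (trunc _ y.1.dropLast), [letter τ, g])
  | some (_, g) => (.fail, [g])

/-- The move in a given state with a given view. -/
def next (s : State A n r R.bound) (x : Option A) (v : View A n) :
    Option (State A n r R.bound × List (PushSym A n)) :=
  match s, x with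
  | .read q₀ q _, some a => some (.pull q₀ q a (trunc _ []), keep v)
  | .pull q₀ q a u, none =>
      some (if R.window ≤ u.1.length then
        (.cancel q₀ (R.rule a q u.1).1 (trunc _ (R.rule a q u.1).2), keep v)
        else R.nextPull q₀ q a u v)
  | .absorb q₀ q a u, none => some (R.nextAbsorb q₀ q a u v)
  | .cancel q₀ q y, none => some (R.nextCancel q₀ q y v)
  | .write q₀ q y, none =>
      some (match y.1.getLast? with
        | none => (.read q₀ q v.isSome, keep v)
        | some τ => R.nextWrite q₀ q y τ v)
  | _, _ => none

instance finite_state [Finite A] (m : ℕ) : Finite (State A n r m) := by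
  have : Finite (Buffer n m) := List.finite_length_le (Fin n) m
  let code : State A n r m → Option (Fin r × Fin r ×
      (Bool ⊕ (A × Buffer n m) ⊕ (A × Buffer n m) ⊕ Buffer n m ⊕ Buffer n m))
    | .read q₀ q b => some (q₀, q, .inl b)
    | .pull q₀ q a u => some (q₀, q, .inr (.inl (a, u)))
    | .absorb q₀ q a u => some (q₀, q, .inr (.inr (.inl (a, u))))
    | .cancel q₀ q y => some (q₀, q, .inr (.inr (.inr (.inl y))))
    | .write q₀ q y => some (q₀, q, .inr (.inr (.inr (.inr y))))
    | .fail => none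
  refine Finite.of_injective code ?_
  intro s t h
  cases s <;> cases t <;> simp_all [code]

/-! ### Termination and progress -/

/-- A bound for the number of moves before the next letter is read. -/
def rank : State A n r R.bound → ℕ
  | .read .. => 0
  -- Cancelling and writing have rank at most `2 * R.bound + 2`. Each missing letter of the window
  -- takes at most two moves, so the factor three is ample.
  | .pull _ _ _ u => 2 * R.bound + 3 + 3 * (R.window - u.1.length)
  | .absorb _ _ _ u => 2 * R.bound + 4 + 3 * (R.window - u.1.length - 1)
  | .cancel _ _ y => R.bound + 2 + y.1.length
  | .write _ _ y => y.1.length + 1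
  | .fail => 0

theorem rank_nextPull (q₀ q : Fin r) (a : A) (u : Buffer n R.bound) (v : View A n)
    (h : u.1.length < R.window) :
    R.rank (R.nextPull q₀ q a u v).1 < R.rank (.pull q₀ q a u) := by
  have := R.window_le
  unfold nextPull
  split <;> simp only [rank, length_trunc, List.length_append, List.length_singleton] <;> omega

theorem rank_nextAbsorb (q₀ q : Fin r) (a : A) (u : Buffer n R.bound) (v : View A n) :
    R.rank (R.nextAbsorb q₀ q a u v).1 < R.rank (.absorb q₀ q a u) := by
  have := R.window_le
  have := u.2
  unfold nextAbsorb
  split <;> simp only [rank, length_trunc, List.length_append, List.length_singleton] <;> omega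

theorem rank_nextCancel (q₀ q : Fin r) (y : Buffer n R.bound) (v : View A n) :
    R.rank (R.nextCancel q₀ q y v).1 < R.rank (.cancel q₀ q y) := by
  have := y.2
  unfold nextCancel
  split
  · rename_i σ b
    split_ifs with h
    · have : 0 < y.1.length := by
        rw [List.length_pos_iff]
        rintro h'
        simp [h'] at h
      simp only [rank, length_trunc, List.length_dropLast]
      omega
    · simp only [rank]
      omega
  · simp only [rank]
    omega

theorem rank_nextWrite (q₀ q : Fin r) (y : Buffer n R.bound) (τ : Fin n) (v : View A n)
    (h : 0 < y.1.length) :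
    R.rank (R.nextWrite q₀ q y τ v).1 < R.rank (.write q₀ q y) := by
  have := y.2
  unfold nextWrite
  split <;> simp only [rank, length_trunc, List.length_dropLast] <;> omega

theorem rank_lt_of_next {s s' : State A n r R.bound} {v : View A n} {w : List (PushSym A n)}
    (h : R.next s none v = some (s', w)) : R.rank s' < R.rank s := by
  cases s with
  | read q₀ q b => simp [next] at h
  | pull q₀ q a u =>
    simp only [next, Option.some.injEq] at h
    split_ifs at h with hu
    · obtain ⟨rfl, -⟩ := Prod.mk.inj h
      simp only [rank, length_trunc]
      omega
    · have := R.rank_nextPull q₀ q a u v (by omega)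
      rwa [h] at this
  | absorb q₀ q a u =>
    have := R.rank_nextAbsorb q₀ q a u v
    simp only [next, Option.some.injEq] at h
    rwa [h] at this
  | cancel q₀ q y =>
    have := R.rank_nextCancel q₀ q y v
    simp only [next, Option.some.injEq] at h
    rwa [h] at this
  | write q₀ q y =>
    simp only [next, Option.some.injEq] at h
    split at h
    · obtain ⟨rfl, -⟩ := Prod.mk.inj h
      simp [rank]
    · rename_i τ hτ
      have := R.rank_nextWrite q₀ q y τ v (by
        rw [List.length_pos_iff]
        rintro h'
        simp [h'] at hτ)
      rwa [h] at this
  | fail => simp [next] at h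

/-! ### The height of the pushdown stack -/

/-- How many symbols may be pushed after one symbol was popped. -/
def room : View A n → ℕ
  | some (some (.inl (_, false)), _) => 2
  | _ => 1

theorem one_le_room (v : View A n) : 1 ≤ room v := by
  unfold room
  split <;> omega

theorem length_keep (v : View A n) : (keep v).length ≤ room v := by
  refine le_trans ?_ (one_le_room v)
  unfold keep
  split <;> simp

theorem length_le_room {s s' : State A n r R.bound} {x : Option A} {v : View A n}
    {w : List (PushSym A n)} (h : R.next s x v = some (s', w)) : w.length ≤ room v := by
  have h₀ := length_keep v
  have h₁ := one_le_room v
  cases s with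
  | read q₀ q b =>
    cases x with
    | none => simp [next] at h
    | some a =>
      simp only [next, Option.some.injEq, Prod.mk.injEq] at h
      obtain ⟨-, rfl⟩ := h; exact h₀
  | pull q₀ q a u =>
    cases x with
    | some a => simp [next] at h
    | none =>
      simp only [next, Option.some.injEq] at h
      split_ifs at h
      · obtain ⟨-, rfl⟩ := Prod.mk.inj h; exact h₀
      · unfold nextPull at h
        split at h <;> obtain ⟨-, rfl⟩ := Prod.mk.inj h <;> simp_all [room]
  | absorb q₀ q a u =>
    cases x with
    | some a => simp [next] at h
    | none =>
      simp only [next, Option.some.injEq] at h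
      unfold nextAbsorb at h
      split at h <;> obtain ⟨-, rfl⟩ := Prod.mk.inj h <;> simp_all
  | cancel q₀ q y =>
    cases x with
    | some a => simp [next] at h
    | none =>
      simp only [next, Option.some.injEq] at h
      unfold nextCancel at h
      split at h
      · split_ifs at h <;> obtain ⟨-, rfl⟩ := Prod.mk.inj h <;> simp_all
      · obtain ⟨-, rfl⟩ := Prod.mk.inj h; exact h₀
  | write q₀ q y =>
    cases x with
    | some a => simp [next] at h
    | none =>
      simp only [next, Option.some.injEq] at h
      split at h
      · obtain ⟨-, rfl⟩ := Prod.mk.inj h; exact h₀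
      · unfold nextWrite at h
        split at h <;> obtain ⟨-, rfl⟩ := Prod.mk.inj h <;> simp_all [room]
  | fail => simp [next] at h

/-- The check stack with contents `x ++ [z]`. -/
def checkStack (x : List (Fin n)) (z : Fin n) : List (CheckSym A n) :=
  x.map (fun σ => .inl (σ, false)) ++ [.inl (z, true)]

@[simp] theorem length_checkStack (x : List (Fin n)) (z : Fin n) :
    (checkStack (A := A) x z).length = x.length + 1 := by
  simp [checkStack]

theorem getElem?_checkStack {x : List (Fin n)} {z : Fin n} {i : ℕ} (h : i ≤ x.length) :
    ∃ σ, (x ++ [z])[i]? = some σ ∧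
      (checkStack (A := A) x z)[i]? = some (.inl (σ, decide (i = x.length))) := by
  rcases h.lt_or_eq with h | rfl
  · refine ⟨x[i], by rw [List.getElem?_append_left h, List.getElem?_eq_getElem h], ?_⟩
    simp only [checkStack]
    rw [List.getElem?_append_left (by simpa using h)]
    simp [h, h.ne]
  · exact ⟨z, by simp, by simp [checkStack]⟩

/-! ### The automaton -/

/-- The automaton.  The first stage writes a non-empty word over `Fin n` to the check stack, with
its last letter flagged, and chooses a letter of `Fin r`. -/
abbrev machine [Finite A] : CSPDA A where
  Init := Bool
  State := State A n r R.bound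
  Check := CheckSym A n
  Push := PushSym A n
  finite_Init := inferInstance
  finite_State := inferInstance
  finite_Check := inferInstance
  finite_Push := inferInstance
  checkLetter := .inr
  pushLetter := .inr
  start := false
  silentMove _ := ∅
  writeMove s := {t | s = false ∧ ∃ σ, t.1 = .inl (σ, t.2)}
  enter s := {t | s = true ∧ ∃ q, t = .read q q false}
  trans s x v := (R.next s x v).toFinset
  accept := {s | ∃ q₀ q b, s = .read q₀ q b ∧ (q ≠ q₀ ∨ b = true)}
  reading := {s | ∃ q₀ q b, s = .read q₀ q b}

section

variable [Finite A]

theorem mem_trans {s s' : State A n r R.bound} {x : Option A} {v : View A n}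
    {w : List (PushSym A n)} :
    (s', w) ∈ R.machine.trans s x v ↔ R.next s x v = some (s', w) := by
  simp [machine]

theorem writes_iff {s : R.machine.Init} {c : List R.machine.Check} :
    R.machine.Writes s c ↔ (s = false ∧ ∃ x : List (Fin n), c = x.map fun σ => .inl (σ, false)) ∨
      (s = true ∧ ∃ x z, c = checkStack x z) := by
  constructor
  · intro h
    induction h with
    | start => exact .inl ⟨rfl, [], rfl⟩
    | silent _ h => exact h.elim
    | @write s t c d _ h ih =>
      obtain ⟨rfl, σ, hσ⟩ := h
      change d = Sum.inl (σ, t) at hσ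
      rcases ih with ⟨-, x, rfl⟩ | ⟨h, -⟩
      · subst hσ
        cases t
        · exact .inl ⟨rfl, x ++ [σ], by simp⟩
        · exact .inr ⟨rfl, x, σ, rfl⟩
      · cases h
  · have key (x : List (Fin n)) :
        R.machine.Writes false (x.map fun σ => .inl (σ, false)) := by
      induction x using List.reverseRecOn with
      | nil => exact .start
      | append_singleton x σ ih =>
        rw [List.map_append]
        exact .write (t := false) (d := Sum.inl (σ, false)) ih ⟨rfl, σ, rfl⟩
    rintro (⟨rfl, x, rfl⟩ | ⟨rfl, x, z, rfl⟩)
    · exact key x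
    · exact .write (t := true) (d := Sum.inl (z, true)) (key x) ⟨rfl, z, rfl⟩

theorem isEntry_iff {C : R.machine.Config} :
    R.machine.IsEntry C ↔ ∃ q x z, C = ⟨.read q q false, checkStack x z, []⟩ := by
  constructor
  · rintro ⟨hp, s, hs, rfl, q, hq⟩
    rcases R.writes_iff.1 hs with ⟨h, -⟩ | ⟨-, x, z, hc⟩
    · cases h
    · exact ⟨q, x, z, CSPDA.Config.ext hq hc hp⟩
  · rintro ⟨q, x, z, rfl⟩
    exact ⟨rfl, true, R.writes_iff.2 (.inr ⟨rfl, x, z, rfl⟩), rfl, q, rfl⟩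

/-! ### The automaton is in normal form -/

theorem edge_of_next {s s' : State A n r R.bound} {x : Option A} {v : View A n}
    {w : List (PushSym A n)} (h : R.next s x v = some (s', w)) : R.machine.Edge s s' :=
  ⟨x, v, w, R.mem_trans.2 h⟩

theorem isFail_fail : R.machine.IsFail (.fail : State A n r R.bound) := by
  intro q' h
  rcases h.cases_head with rfl | ⟨s, ⟨x, v, w, h⟩, -⟩
  · rintro ⟨q₀, q, b, h, -⟩
    cases h
  · have := R.mem_trans.1 h
    simp [next] at this

/-- Paths in the transition graph may use any views, whether or not they occur in one run. The last
view is chosen nonempty, so that the path ends in an accepting state. -/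
theorem write_reaches (q₀ q : Fin r) (y : Buffer n R.bound) :
    Relation.ReflTransGen R.machine.Edge (.write q₀ q y : State A n r R.bound)
      (.read q₀ q true : State A n r R.bound) := by
  obtain ⟨y, hy⟩ := y
  induction y using List.reverseRecOn with
  | nil =>
    exact .single (R.edge_of_next (x := none) (v := some (none, marker)) (w := [marker])
      (by simp [next, keep]))
  | append_singleton y τ ih =>
    have hy' : y.length ≤ R.bound := by simp at hy; omega
    refine .head (R.edge_of_next (x := none) (v := none) (w := [letter τ]) ?_) (ih hy')
    simp only [next, List.getLast?_append, List.getLast?_singleton, Option.some_or, nextWrite,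
      List.dropLast_concat]
    congr
    exact Subtype.ext (trunc_val hy')

theorem cancel_reaches (q₀ q : Fin r) (y : Buffer n R.bound) :
    Relation.ReflTransGen R.machine.Edge (.cancel q₀ q y : State A n r R.bound)
      (.read q₀ q true : State A n r R.bound) :=
  .head (R.edge_of_next (x := none) (v := none) (w := []) rfl) (R.write_reaches q₀ q y)

theorem pull_reaches (q₀ q : Fin r) (a : A) (σ : Fin n) (u : Buffer n R.bound) :
    ∃ q', Relation.ReflTransGen R.machine.Edge (.pull q₀ q a u : State A n r R.bound)
      (.read q₀ q' true : State A n r R.bound) := by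
  obtain ⟨k, hk⟩ : ∃ k, R.window - u.1.length = k := ⟨_, rfl⟩
  induction k generalizing u with
  | zero =>
    exact ⟨_, .head (R.edge_of_next (x := none) (v := none) (w := [])
      (by rw [next, if_pos (by omega), keep])) (R.cancel_reaches q₀ _ _)⟩
  | succ k ih =>
    obtain ⟨q', h⟩ := ih (trunc _ (u.1 ++ [σ])) (by
      have := R.window_le
      simp only [length_trunc, List.length_append, List.length_singleton]
      omega)
    exact ⟨q', .head (R.edge_of_next (x := none) (v := some (none, letter σ)) (w := [])
      (by rw [next, if_neg (by omega)]; rfl)) h⟩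

/-- A non-accepting reading state can be left only by reading a letter, which is why `A` must be
nonempty. -/
theorem eq_fail_of_isFail [Nonempty A] (σ : Fin n) {s : State A n r R.bound}
    (h : R.machine.IsFail s) : s = .fail := by
  obtain ⟨a⟩ := ‹Nonempty A›
  have acc (q₀ q : Fin r) :
      (.read q₀ q true : State A n r R.bound) ∈ R.machine.accept := ⟨q₀, q, true, rfl, .inr rfl⟩
  cases s with
  | read q₀ q b =>
    obtain ⟨q', h'⟩ := R.pull_reaches q₀ q a σ (trunc _ [])
    exact (h _ (.head (R.edge_of_next (x := some a) (v := none) (w := []) rfl) h') (acc _ _)).elim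
  | pull q₀ q a u =>
    obtain ⟨q', h'⟩ := R.pull_reaches q₀ q a σ u
    exact (h _ h' (acc _ _)).elim
  | absorb q₀ q a u =>
    obtain ⟨q', h'⟩ := R.pull_reaches q₀ q a σ (trunc _ (u.1 ++ [σ]))
    exact (h _ (.head (R.edge_of_next (x := none) (v := some (some (.inl (σ, true)), marker))
      (w := [marker]) rfl) h') (acc _ _)).elim
  | cancel q₀ q y => exact (h _ (R.cancel_reaches q₀ q y) (acc _ _)).elim
  | write q₀ q y => exact (h _ (R.write_reaches q₀ q y) (acc _ _)).elim
  | fail => rfl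

theorem normal [Nonempty A] (σ : Fin n) : R.machine.Normal where
  of_reading := by
    rintro _ ⟨q₀, q, b, rfl⟩ v
    rfl
  of_not_reading := by
    intro s hs a v
    cases s with
    | read q₀ q b => exact (hs ⟨q₀, q, b, rfl⟩).elim
    | _ => rfl
  fail_unique q q' h h' := (R.eq_fail_of_isFail σ h).trans (R.eq_fail_of_isFail σ h').symm
  fail_not_reading := by
    intro q h
    obtain rfl := R.eq_fail_of_isFail σ h
    rintro ⟨q₀, q, b, h⟩
    cases h
  fail_stop := by
    intro q h x v
    obtain rfl := R.eq_fail_of_isFail σ h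
    rfl

theorem deterministic (s : R.machine.State) (x : Option A)
    (v : Option (Option R.machine.Check × R.machine.Push)) :
    (R.machine.trans s x v : Set (R.machine.State × List R.machine.Push)).Subsingleton := by
  rintro ⟨s₁, w₁⟩ h₁ ⟨s₂, w₂⟩ h₂
  have h₁ := R.mem_trans.1 h₁
  have h₂ := R.mem_trans.1 h₂
  exact Option.some.inj (h₁.symm.trans h₂)

theorem no_infinite :
    ¬ ∃ f : ℕ → R.machine.Config, ∀ i, R.machine.Step (f i) none (f (i + 1)) := by
  rintro ⟨f, hf⟩
  have h (i : ℕ) : R.rank (f (i + 1)).state < R.rank (f i).state := by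
    have := hf i
    generalize f (i + 1) = D at this
    obtain ⟨h⟩ := this
    exact R.rank_lt_of_next (R.mem_trans.1 h)
  have h' (i : ℕ) : R.rank (f i).state + i ≤ R.rank (f 0).state := by
    induction i with
    | zero => rfl
    | succ i ih => have := h i; omega
  have := h' (R.rank (f 0).state + 1)
  omega

theorem exists_step {D : R.machine.Config} {x : Option A}
    (h : (R.next D.state x D.view).isSome) : ∃ D', R.machine.Step D x D' := by
  obtain ⟨⟨s, w⟩, h⟩ := Option.isSome_iff_exists.1 h
  exact ⟨_, .move (R.mem_trans.2 h)⟩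

/-- The form of the check stack is part of the invariant: its flag marks exactly the top, and `room`
lets the stack grow from a nonempty state only below the flag. -/
theorem bounded {D : R.machine.Config} (h : R.machine.Reachable D) :
    (∃ x z, D.check = checkStack x z) ∧ D.push.length ≤ D.check.length := by
  refine CSPDA.Reachable.induction (P := fun D => (∃ x z, D.check = checkStack x z) ∧
    D.push.length ≤ D.check.length) ?_ ?_ h
  · intro C hC
    obtain ⟨q, x, z, rfl⟩ := R.isEntry_iff.1 hC
    exact ⟨⟨x, z, rfl⟩, Nat.zero_le _⟩
  · rintro ⟨s, c, p⟩ y D ⟨h⟩ ⟨⟨x, z, rfl⟩, hle⟩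
    refine ⟨⟨x, z, rfl⟩, ?_⟩
    have hw := R.length_le_room (R.mem_trans.1 h)
    clear h
    simp only [List.length_append, List.length_tail]
    cases p with
    -- One symbol may be pushed onto the empty stack because the check stack is never empty.
    | nil =>
      have : (checkStack (A := A) x z).length = x.length + 1 := length_checkStack x z
      simp only [CSPDA.Config.view, room] at hw
      simp only [List.length_nil]
      omega
    | cons g p =>
      have hl : (checkStack (A := A) x z).length = x.length + 1 := length_checkStack x z
      simp only [List.length_cons] at hle ⊢
      obtain ⟨σ, -, hσ⟩ := getElem?_checkStack (A := A) (x := x) (z := z) (i := p.length)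
        (by omega)
      simp only [CSPDA.Config.view] at hw
      erw [hσ] at hw
      rcases eq_or_ne p.length x.length with hp | hp
      · simp only [hp, decide_true, room] at hw
        omega
      · simp only [hp, decide_false, room] at hw
        omega

end

end PrefixRules

namespace PrefixRules
open HigmanThompson

variable {A : Type} {n r : ℕ}

/-! ### Correctness of the automaton -/

/-- The pushdown stack that stores `p` after removing `j` letters from the check stack. -/
def stack (p : List (Fin n)) (j : ℕ) : List (PushSym A n) :=
  p.map letter ++ List.replicate j marker

@[simp] theorem length_stack (p : List (Fin n)) (j : ℕ) :
    (stack (A := A) p j).length = p.length + j := by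
  simp [stack]

@[simp] theorem stack_cons (τ : Fin n) (p : List (Fin n)) (j : ℕ) :
    stack (A := A) (τ :: p) j = letter τ :: stack p j := rfl

@[simp] theorem stack_nil_zero : stack (A := A) (n := n) [] 0 = [] := rfl

@[simp] theorem stack_nil_succ (j : ℕ) :
    stack (A := A) (n := n) [] (j + 1) = marker :: stack [] j := rfl

/-- No final letter of `p` can be cancelled against `x.take j`. -/
def Reduced (x p : List (Fin n)) (j : ℕ) : Prop :=
  ∀ i σ, j = i + 1 → x[i]? = some σ → p.getLast? ≠ some σ

theorem Reduced.nil (x : List (Fin n)) (j : ℕ) : Reduced x [] j := by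
  intro i σ _ _
  simp

theorem Reduced.zero (x p : List (Fin n)) : Reduced x p 0 := by
  intro i σ h
  omega

theorem Reduced.of_cons {x p : List (Fin n)} {τ : Fin n} {j : ℕ} (h : Reduced x (τ :: p) j) :
    Reduced x p j := by
  cases p with
  | nil => exact .nil x j
  | cons σ p => simpa [Reduced] using h

theorem Reduced.append {x p : List (Fin n)} {j : ℕ} (h : Reduced x p j) (hp : p ≠ [])
    (y : List (Fin n)) : Reduced x (y ++ p) j := by
  intro i σ hj hx
  rw [List.getLast?_append_of_ne_nil _ hp]
  exact h i σ hj hx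

/-- On the points that begin with `q₀` and `x`, the map `g` replaces `x` by `u ++ p ++ x.drop j`
and `q₀` by `q`. -/
structure Tracks (g : Equiv.Perm (Point n r)) (q₀ : Fin r) (x : List (Fin n)) (q : Fin r)
    (u p : List (Fin n)) (j : ℕ) : Prop where
  height : p.length + j ≤ x.length
  reduced : Reduced x p j
  map : ∀ s, g (extend (q₀, x) s) = extend (q, u ++ (p ++ x.drop j)) s

/-! ### Uniqueness of the normal form. -/

/-- This needs two letters: over one letter all words act alike. After common letters are removed, a
string that begins differently from the longer word is a counterexample. -/
theorem append_stream_injective (hn : 2 ≤ n) {l m : List (Fin n)}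
    (h : ∀ s, l ++ₛ s = m ++ₛ s) : l = m := by
  have : Nontrivial (Fin n) := Fin.nontrivial_iff_two_le.2 hn
  have key (m : List (Fin n)) (h : ∀ s : Stream' (Fin n), s = m ++ₛ s) : m = [] := by
    cases m with
    | nil => rfl
    | cons b m =>
      obtain ⟨c, hc⟩ := exists_ne b
      have := congrArg Stream'.head (h (Stream'.const c))
      exact (hc this).elim
  induction l generalizing m with
  | nil => exact (key m h).symm
  | cons a l ih =>
    cases m with
    | nil => exact key _ fun s => (h s).symm
    | cons b m =>
      have hab : a = b := congrArg Stream'.head (h (Stream'.const a))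
      rw [hab, ih fun s => (Stream'.cons_injective2 (h s)).2]

theorem extend_injective (hn : 2 ≤ n) {b c : Word n r} (h : ∀ s, extend b s = extend c s) :
    b = c := by
  have : Nontrivial (Fin n) := Fin.nontrivial_iff_two_le.2 hn
  obtain ⟨σ⟩ : Nonempty (Fin n) := inferInstance
  exact Prod.ext (congrArg Prod.fst (h (Stream'.const σ)) :)
    (append_stream_injective hn fun s => congrArg Prod.snd (h s))

/-- For `j ≤ j'`, comparing the images shows that `p'` is `p` followed by the letters of `x` at
positions from `j` to `j' - 1`. If `j < j'`, the last letter of `p'` is the last removed letter of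
`x`, against `Reduced`. -/
theorem Tracks.unique (hn : 2 ≤ n) {g : Equiv.Perm (Point n r)} {q₀ q q' : Fin r}
    {x p p' : List (Fin n)} {j j' : ℕ} (h : Tracks g q₀ x q [] p j)
    (h' : Tracks g q₀ x q' [] p' j') : q = q' ∧ p = p' ∧ j = j' := by
  wlog hj : j ≤ j' generalizing q q' p p' j j'
  · obtain ⟨rfl, rfl, rfl⟩ := this h' h (by omega)
    exact ⟨rfl, rfl, rfl⟩
  have h₁ := extend_injective hn fun s => (h.map s).symm.trans (h'.map s)
  obtain ⟨rfl, h₂⟩ := Prod.mk.inj h₁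
  simp only [List.nil_append] at h₂
  obtain ⟨k, rfl⟩ := Nat.exists_eq_add_of_le hj
  have h₃ : x.drop j = (x.drop j).take k ++ x.drop (j + k) := by
    rw [← List.drop_drop, List.take_append_drop]
  rw [h₃, ← List.append_assoc] at h₂
  have h₄ := List.append_cancel_right h₂
  cases k with
  | zero => exact ⟨rfl, by simpa using h₄, rfl⟩
  | succ k =>
    have hlt : j + k < x.length := by have := h'.height; omega
    refine (h'.reduced (j + k) x[j + k] rfl (List.getElem?_eq_getElem hlt) ?_).elim
    rw [← h₄, List.take_succ_eq_append_getElem (by simp; omega), ← List.append_assoc]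
    simp

theorem foldl_mul (act : A → Equiv.Perm (Point n r)) (g : Equiv.Perm (Point n r)) (w : List A) :
    w.foldl (fun g a => act a * g) g = w.foldl (fun g a => act a * g) 1 * g := by
  induction w generalizing g with
  | nil => simp
  | cons a w ih =>
    rw [List.foldl_cons, ih, List.foldl_cons, ih (act a * 1), mul_one, mul_assoc]

variable (R : PrefixRules A n r) [Finite A]

/-- A configuration of the automaton. -/
abbrev config (s : State A n r R.bound) (x : List (Fin n)) (z : Fin n)
    (p : List (PushSym A n)) : R.machine.Config :=
  ⟨s, checkStack x z, p⟩

theorem view_config_cons (s : State A n r R.bound) {x : List (Fin n)} {z : Fin n}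
    {g : PushSym A n} {p : List (PushSym A n)} (h : p.length ≤ x.length) :
    ∃ σ, (x ++ [z])[p.length]? = some σ ∧ (R.config s x z (g :: p)).view =
      some (some (.inl (σ, decide (p.length = x.length))), g) := by
  obtain ⟨σ, h₁, h₂⟩ := getElem?_checkStack (A := A) (z := z) h
  refine ⟨σ, h₁, ?_⟩
  rw [← h₂]
  rfl

theorem step_of_next {s s' : State A n r R.bound} {x : List (Fin n)} {z : Fin n}
    {p p' w : List (PushSym A n)} {o : Option A}
    (h : R.next s o (R.config s x z p).view = some (s', w)) (hw : w ++ p.tail = p') :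
    R.machine.Step (R.config s x z p) o (R.config s' x z p') := by
  subst hw
  exact .move (R.mem_trans.2 h)

theorem keep_append_tail (s : State A n r R.bound) (x : List (Fin n)) (z : Fin n)
    (p : List (PushSym A n)) : keep (R.config s x z p).view ++ p.tail = p := by
  cases p <;> rfl

/-- In some run of moves that read nothing, the automaton enters the fail state. -/
def Dies (C : R.machine.Config) : Prop :=
  ∃ D, R.machine.Run C [] D ∧ D.state = .fail

variable {R}

theorem Dies.of_run {C D : R.machine.Config} (h : R.Dies D) (hC : R.machine.Run C [] D) :
    R.Dies C := by
  obtain ⟨E, hE, h⟩ := h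
  exact ⟨E, hC.trans hE, h⟩

/-! ### The phases of one replacement. -/

variable {g : Equiv.Perm (Point n r)} {q₀ q : Fin r} {x : List (Fin n)} {z : Fin n}

/-- Induction on the number of missing letters. A letter taken from `p` lowers the stack, one taken
from the check stack raises it by one, so failure forces the stated lower bound on the height. -/
theorem pull_run (a : A) {u p : List (Fin n)} {j : ℕ} (hu : u.length ≤ R.window)
    (h : Tracks g q₀ (x ++ [z]) q u p j) :
    (∃ u' p' j', u'.length = R.window ∧ Tracks g q₀ (x ++ [z]) q u' p' j' ∧
      p'.length + j' ≤ p.length + j + (R.window - u.length) ∧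
      R.machine.Run (R.config (.pull q₀ q a (trunc _ u)) x z (stack p j)) []
        (R.config (.pull q₀ q a (trunc _ u')) x z (stack p' j'))) ∨
    x.length < p.length + j + (R.window - u.length) ∧
      R.Dies (R.config (.pull q₀ q a (trunc _ u)) x z (stack p j)) := by
  obtain ⟨k, hk⟩ : ∃ k, R.window - u.length = k := ⟨_, rfl⟩
  induction k generalizing u p j with
  | zero => exact .inl ⟨u, p, j, by omega, h, by omega, .refl _⟩
  | succ k ih =>
    have hle := R.window_le
    have hut : (trunc R.bound u).1 = u := trunc_val (by omega)
    have hnext (v : View A n) : R.next (.pull q₀ q a (trunc _ u)) none v =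
        some (R.nextPull q₀ q a (trunc _ u) v) := by
      rw [next, if_neg (by rw [hut]; omega)]
    cases p with
    | cons τ p =>
      have hstep : R.machine.Run (R.config (.pull q₀ q a (trunc _ u)) x z (stack (τ :: p) j)) []
          (R.config (.pull q₀ q a (trunc _ (u ++ [τ]))) x z (stack p j)) := by
        refine .single (R.step_of_next (w := []) ?_ rfl)
        rw [hnext, ← congrArg (fun l => trunc R.bound (l ++ [τ])) hut]
        rfl
      have hheight := h.height
      rw [List.length_cons] at hheight
      rcases ih (u := u ++ [τ]) (p := p) (j := j) (by simp; omega)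
        ⟨by omega, h.reduced.of_cons, by simpa using h.map⟩ (by simp; omega) with
        ⟨u', p', j', h₁, h₂, h₃, h₄⟩ | ⟨h₁, h₂⟩
      · refine .inl ⟨u', p', j', h₁, h₂, ?_, hstep.trans h₄⟩
        simp at h₃ ⊢
        omega
      · refine .inr ⟨?_, h₂.of_run hstep⟩
        simp at h₁ ⊢
        omega
    | nil =>
      have hheight := h.height
      simp only [List.length_nil, List.length_append, List.length_singleton] at hheight
      rcases (show j ≤ x.length ∨ j = x.length + 1 by omega) with hj | rfl
      · have hstep₁ : R.machine.Step (R.config (.pull q₀ q a (trunc _ u)) x z (stack [] j)) none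
            (R.config (.absorb q₀ q a (trunc _ u)) x z (stack [] (j + 1))) := by
          cases j with
          | zero => exact R.step_of_next (w := [marker]) (by rw [hnext]; rfl) rfl
          | succ i =>
            obtain ⟨σ, -, hv⟩ := R.view_config_cons (.pull q₀ q a (trunc _ u)) (x := x) (z := z)
              (g := marker) (p := stack [] i) (by simp; omega)
            refine R.step_of_next (w := [marker, marker]) ?_ rfl
            rw [hnext, stack_nil_succ, hv]
            have : ¬ i = x.length := by omega
            simp only [length_stack, List.length_nil, zero_add, this, decide_false]
            rfl
        obtain ⟨σ, hσ, hv⟩ := R.view_config_cons (.absorb q₀ q a (trunc _ u)) (x := x) (z := z)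
          (g := marker) (p := stack [] j) (by simpa using hj)
        have hstep₂ : R.machine.Step
            (R.config (.absorb q₀ q a (trunc _ u)) x z (stack [] (j + 1))) none
            (R.config (.pull q₀ q a (trunc _ (u ++ [σ]))) x z (stack [] (j + 1))) := by
          refine R.step_of_next (w := [marker]) ?_ rfl
          rw [stack_nil_succ, hv, ← congrArg (fun l => trunc R.bound (l ++ [σ])) hut]
          rfl
        have hstep := CSPDA.Run.silent hstep₁ (.single hstep₂)
        have hσ' : (x ++ [z]).drop j = σ :: (x ++ [z]).drop (j + 1) := by
          have hj' : j < (x ++ [z]).length := by simp; omega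
          rw [List.drop_eq_getElem_cons hj']
          simp only [length_stack, List.length_nil, zero_add, List.getElem?_eq_getElem hj',
            Option.some.injEq] at hσ
          rw [hσ]
        rcases ih (u := u ++ [σ]) (p := []) (j := j + 1) (by simp; omega)
          ⟨by simp; omega, .nil _ _, fun s => by rw [h.map, hσ']; simp⟩ (by simp; omega) with
          ⟨u', p', j', h₁, h₂, h₃, h₄⟩ | ⟨h₁, h₂⟩
        · refine .inl ⟨u', p', j', h₁, h₂, ?_, hstep.trans h₄⟩
          simp at h₃ ⊢
          omega
        · refine .inr ⟨?_, h₂.of_run hstep⟩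
          simp at h₁ ⊢
          omega
      -- All letters of the check stack are removed, and the top marker stands at the flag.
      · refine .inr ⟨by simp; omega, R.config .fail x z (stack [] (x.length + 1)), .single ?_, rfl⟩
        obtain ⟨σ, -, hv⟩ := R.view_config_cons (.pull q₀ q a (trunc _ u)) (x := x) (z := z)
          (g := marker) (p := stack [] x.length) (by simp)
        refine R.step_of_next (w := [marker]) ?_ rfl
        rw [hnext, stack_nil_succ, hv]
        simp only [length_stack, List.length_nil, zero_add, decide_true]
        rfl

/-- If `p` is not empty, its last letter is still the last one and `Reduced` is inherited. If it is
empty, the comparison that stops the loop is exactly `Reduced` for the remaining word. -/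
theorem cancel_run {y p : List (Fin n)} {j : ℕ} (hy : y.length ≤ R.bound)
    (h : Tracks g q₀ (x ++ [z]) q y p j) :
    ∃ y' j', y'.length ≤ y.length ∧ j' ≤ j ∧ Reduced (x ++ [z]) (y' ++ p) j' ∧
      (∀ s, g (extend (q₀, x ++ [z]) s) =
        extend (q, y' ++ (p ++ (x ++ [z]).drop j')) s) ∧
      R.machine.Run (R.config (.cancel q₀ q (trunc _ y)) x z (stack p j)) []
        (R.config (.write q₀ q (trunc _ y')) x z (stack p j')) := by
  have hyt : (trunc R.bound y).1 = y := trunc_val hy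
  cases p with
  | cons τ p =>
    refine ⟨y, j, le_rfl, le_rfl, h.reduced.append (by simp) y, h.map, .single
      (R.step_of_next (w := [letter τ]) ?_ rfl)⟩
    have hnext (c : Option (CheckSym A n)) : R.next (.cancel q₀ q (trunc _ y)) none
        (some (c, letter τ)) = some (.write q₀ q (trunc _ y), [letter τ]) := by
      simp only [next, nextCancel, letter, keep]
    exact hnext _
  | nil =>
    induction j generalizing y with
    | zero =>
      exact ⟨y, 0, le_rfl, le_rfl, .zero _ _, h.map, .single
        (R.step_of_next (w := []) rfl rfl)⟩
    | succ j ih =>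
      have hheight := h.height
      simp only [List.length_nil, List.length_append, List.length_singleton] at hheight
      obtain ⟨σ, hσ, hv⟩ := R.view_config_cons (.cancel q₀ q (trunc _ y)) (x := x) (z := z)
        (g := marker) (p := stack [] j) (by simp; omega)
      simp only [length_stack, List.length_nil, zero_add] at hσ
      have hj' : j < (x ++ [z]).length := by simp; omega
      by_cases hlast : y.getLast? = some σ
      · obtain ⟨y, rfl⟩ := List.getLast?_eq_some_iff.1 hlast
        have hσ' : (x ++ [z]).drop j = σ :: (x ++ [z]).drop (j + 1) := by
          rw [List.drop_eq_getElem_cons hj']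
          simp only [List.getElem?_eq_getElem hj', Option.some.injEq] at hσ
          rw [hσ]
        have hyl : y.length ≤ R.bound := by simp at hy; omega
        have hstep : R.machine.Step
            (R.config (.cancel q₀ q (trunc _ (y ++ [σ]))) x z (stack [] (j + 1))) none
            (R.config (.cancel q₀ q (trunc _ y)) x z (stack [] j)) := by
          refine R.step_of_next (w := []) ?_ rfl
          rw [stack_nil_succ, hv]
          simp only [next, nextCancel, marker, hyt, hlast, if_true, List.dropLast_concat]
        obtain ⟨y', j', h₁, h₂, h₃, h₄, h₅⟩ := ih (y := y) hyl (trunc_val hyl)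
          ⟨by simp; omega, .nil _ _, fun s => by rw [h.map, hσ']; simp⟩
        exact ⟨y', j', by simp; omega, by omega, h₃, h₄, .silent hstep h₅⟩
      · refine ⟨y, j + 1, le_rfl, le_rfl, ?_, h.map, .single
          (R.step_of_next (w := [marker]) ?_ rfl)⟩
        · intro i τ hi hτ
          obtain rfl : j = i := by omega
          rw [hσ] at hτ
          rwa [List.append_nil, ← hτ]
        · rw [stack_nil_succ, hv]
          simp only [next, nextCancel, marker, hyt, hlast, if_false, keep]

theorem write_run {y p : List (Fin n)} {j : ℕ} (hy : y.length ≤ R.bound)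
    (h : p.length + j ≤ x.length + 1) :
    (y.length + p.length + j ≤ x.length + 1 ∧
      R.machine.Run (R.config (.write q₀ q (trunc _ y)) x z (stack p j)) []
        (R.config (.read q₀ q (decide (0 < y.length + p.length + j))) x z (stack (y ++ p) j))) ∨
    x.length < y.length + p.length + j ∧
      R.Dies (R.config (.write q₀ q (trunc _ y)) x z (stack p j)) := by
  have hyt : (trunc R.bound y).1 = y := trunc_val hy
  induction y using List.reverseRecOn generalizing p with
  | nil =>
    refine .inl ⟨by simpa using h, .single (R.step_of_next
      (w := keep (R.config (.write q₀ q (trunc _ [])) x z (stack p j)).view) ?_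
        (R.keep_append_tail _ _ _ _))⟩
    simp only [next, hyt, List.getLast?_nil, List.length_nil, zero_add]
    congr
    rcases p with _ | ⟨τ, p⟩
    · cases j <;> simp [CSPDA.Config.view]
    · simp [CSPDA.Config.view]
  | append_singleton y τ ih =>
    have hyl : y.length ≤ R.bound := by simp at hy; omega
    have hnext (v : View A n) : R.next (.write q₀ q (trunc _ (y ++ [τ]))) none v =
        some (R.nextWrite q₀ q (trunc _ (y ++ [τ])) τ v) := by
      simp only [next, hyt, List.getLast?_append, List.getLast?_singleton, Option.some_or]
    have hd : trunc R.bound (trunc R.bound (y ++ [τ])).1.dropLast = trunc R.bound y := by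
      rw [hyt, List.dropLast_concat]
    rcases (show p.length + j < x.length + 1 ∨ p.length + j = x.length + 1 by omega) with hlt | heq
    · have hstep : R.machine.Step
          (R.config (.write q₀ q (trunc _ (y ++ [τ]))) x z (stack p j)) none
          (R.config (.write q₀ q (trunc _ y)) x z (stack (τ :: p) j)) := by
        rw [stack_cons]
        have hl := length_stack (A := A) p j
        cases hs : stack (A := A) p j with
        | nil =>
          refine R.step_of_next (w := [letter τ]) ?_ rfl
          rw [hnext, ← hd]
          rfl
        | cons g w =>
          rw [hs, List.length_cons] at hl
          obtain ⟨σ, -, hv⟩ := R.view_config_cons (.write q₀ q (trunc _ (y ++ [τ]))) (x := x)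
            (z := z) (g := g) (p := w) (by omega)
          refine R.step_of_next (w := [letter τ, g]) ?_ rfl
          have : ¬ w.length = x.length := by omega
          rw [hnext, hv, ← hd]
          simp only [this, decide_false, nextWrite]
      rcases ih (p := τ :: p) hyl (by simp; omega) (trunc_val hyl) with ⟨h₁, h₂⟩ | ⟨h₁, h₂⟩
      · refine .inl ⟨by simp at h₁ ⊢; omega, ?_⟩
        have := CSPDA.Run.silent hstep h₂
        simpa [add_assoc, add_comm, add_left_comm] using this
      · exact .inr ⟨by simp at h₁ ⊢; omega, h₂.of_run (.single hstep)⟩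
    · refine .inr ⟨by simp; omega, R.config .fail x z (stack p j), .single ?_, rfl⟩
      have hl := length_stack (A := A) p j
      cases hs : stack (A := A) p j with
      | nil => simp [hs] at hl; omega
      | cons g w =>
        rw [hs, List.length_cons] at hl
        obtain ⟨σ, -, hv⟩ := R.view_config_cons (.write q₀ q (trunc _ (y ++ [τ]))) (x := x)
          (z := z) (g := g) (p := w) (by omega)
        refine R.step_of_next (w := [g]) ?_ rfl
        have : w.length = x.length := by omega
        rw [hnext, hv]
        simp only [this, decide_true, nextWrite]

/-- The configuration, between two replacements, for the current string that begins with `q` and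
`p`, followed by `x.drop j`. -/
abbrev readConfig (R : PrefixRules A n r) (q₀ : Fin r) (x : List (Fin n)) (z : Fin n) (q : Fin r)
    (p : List (Fin n)) (j : ℕ) : R.machine.Config :=
  R.config (.read q₀ q (decide (0 < p.length + j))) x z (stack p j)

variable {act : A → Equiv.Perm (Point n r)}

/-- Pulling raises the stack by at most `R.window`, cancelling never raises it, and writing adds at
most `R.bound`. The sum of the two constants is the growth per input letter. -/
theorem read_run
    (hact : ∀ a q u s, u.length = R.window → act a (extend (q, u) s) = extend (R.rule a q u) s)
    (a : A) {p : List (Fin n)} {j : ℕ} (h : Tracks g q₀ (x ++ [z]) q [] p j) :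
    (∃ q' p' j', Tracks (act a * g) q₀ (x ++ [z]) q' [] p' j' ∧
      p'.length + j' ≤ p.length + j + (R.window + R.bound) ∧
      R.machine.Run (R.readConfig q₀ x z q p j) [a] (R.readConfig q₀ x z q' p' j')) ∨
    x.length < p.length + j + (R.window + R.bound) ∧
      ∃ D, R.machine.Run (R.readConfig q₀ x z q p j) [a] D ∧ D.state = .fail := by
  have hstep : R.machine.Step (R.readConfig q₀ x z q p j) (some a)
      (R.config (.pull q₀ q a (trunc _ [])) x z (stack p j)) :=
    R.step_of_next (w := keep (R.readConfig q₀ x z q p j).view) rfl (R.keep_append_tail _ _ _ _)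
  rcases pull_run (R := R) a (u := []) (Nat.zero_le _) h with
    ⟨u, p₁, j₁, hu, h₁, hle₁, hrun₁⟩ | ⟨h₁, D, hD, hf⟩
  · obtain ⟨q', y, hy⟩ : ∃ q' y, R.rule a q u = (q', y) := ⟨_, _, rfl⟩
    have hyl : y.length ≤ R.bound := by
      have := R.rule_le a q u hu
      rwa [hy] at this
    have hut : (trunc R.bound u).1 = u := trunc_val (by have := R.window_le; omega)
    have hstep₂ : R.machine.Step (R.config (.pull q₀ q a (trunc _ u)) x z (stack p₁ j₁)) none
        (R.config (.cancel q₀ q' (trunc _ y)) x z (stack p₁ j₁)) := by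
      refine R.step_of_next (w := keep (R.config (.pull q₀ q a (trunc _ u)) x z
        (stack p₁ j₁)).view) ?_ (R.keep_append_tail _ _ _ _)
      rw [next, if_pos (by rw [hut, hu]), hut, hy]
    have h₂ : Tracks (act a * g) q₀ (x ++ [z]) q' y p₁ j₁ := by
      refine ⟨h₁.height, h₁.reduced, fun s => ?_⟩
      rw [Equiv.Perm.mul_apply, h₁.map, ← extend_extend, hact a q u _ hu, hy, extend_extend]
    obtain ⟨y', j₂, hyl', hj₂, hred, hmap, hrun₂⟩ := cancel_run (R := R) hyl h₂
    have hheight := h₁.height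
    simp only [List.length_append, List.length_singleton] at hheight
    have hrun := (CSPDA.Run.read hstep hrun₁).trans (.silent hstep₂ hrun₂)
    simp only [List.append_nil, List.length_nil, Nat.sub_zero] at hrun hle₁
    rcases write_run (R := R) (q₀ := q₀) (q := q') (x := x) (z := z) (y := y') (p := p₁) (j := j₂)
      (by omega) (by omega) with ⟨hle, hrun₃⟩ | ⟨hlt, D, hD, hf⟩
    · refine .inl ⟨q', y' ++ p₁, j₂, ⟨by simp; omega, hred, by simpa using hmap⟩,
        by simp; omega, ?_⟩
      have := hrun.trans hrun₃
      simpa only [readConfig, List.length_append, List.append_nil] using this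
    · exact .inr ⟨by omega, D, by simpa using hrun.trans hD, hf⟩
  · simp only [List.length_nil, Nat.sub_zero] at h₁
    exact .inr ⟨by omega, D, .read hstep hD, hf⟩

/-- Failure requires a check stack that is short compared with the input. This is what provides
accepting runs for nontrivial words. -/
theorem word_run
    (hact : ∀ a q u s, u.length = R.window → act a (extend (q, u) s) = extend (R.rule a q u) s)
    (q₀ : Fin r) (x : List (Fin n)) (z : Fin n) (w : List A) :
    (∃ q p j, Tracks (w.foldl (fun g a => act a * g) 1) q₀ (x ++ [z]) q [] p j ∧
      p.length + j ≤ w.length * (R.window + R.bound) ∧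
      R.machine.Run (R.readConfig q₀ x z q₀ [] 0) w (R.readConfig q₀ x z q p j)) ∨
    x.length < w.length * (R.window + R.bound) ∧
      R.machine.Fails (R.readConfig q₀ x z q₀ [] 0) w := by
  induction w using List.reverseRecOn with
  | nil => exact .inl ⟨q₀, [], 0, ⟨by simp, .zero _ _, by simp⟩, by simp, .refl _⟩
  | append_singleton w a ih =>
    have hmul : (w ++ [a]).length * (R.window + R.bound) =
        w.length * (R.window + R.bound) + (R.window + R.bound) := by
      simp only [List.length_append, List.length_singleton, add_mul, one_mul]
    rw [List.foldl_append, List.foldl_cons, List.foldl_nil, hmul]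
    rcases ih with ⟨q, p, j, h₁, h₂, h₃⟩ | ⟨h₁, h₂⟩
    · rcases read_run (R := R) hact a h₁ with ⟨q', p', j', h₄, h₅, h₆⟩ | ⟨h₄, D, h₅, h₆⟩
      · exact .inl ⟨q', p', j', h₄, by omega, h₃.trans h₆⟩
      · refine .inr ⟨by omega, w ++ [a], D, List.prefix_rfl, h₃.trans h₅, ?_⟩
        rw [h₆]
        exact R.isFail_fail
    · exact .inr ⟨by omega, h₂.append _⟩

/-! ### The accepted language and the special conditions. -/

theorem isEntry_readConfig (R : PrefixRules A n r) (q₀ : Fin r) (x : List (Fin n)) (z : Fin n) :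
    R.machine.IsEntry (R.readConfig q₀ x z q₀ [] 0) :=
  R.isEntry_iff.2 ⟨q₀, x, z, rfl⟩

theorem result_readConfig {q₀ q : Fin r} {x : List (Fin n)} {z : Fin n} {p : List (Fin n)}
    {j : ℕ} {w : List A} {C : R.machine.Config}
    (h : R.machine.Run C w (R.readConfig q₀ x z q p j)) :
    R.machine.Result C w (R.readConfig q₀ x z q p j) :=
  ⟨h, _, _, _, rfl⟩

/-- The non-accepting reading configurations that occur are those with normal form `(q₀, [], 0)`,
where the permutation fixes the guessed cone pointwise. For a trivial permutation every guess leads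
there or to failure. -/
theorem mem_language_iff [Nonempty A] (hn : 2 ≤ n)
    (hact : ∀ a q u s, u.length = R.window → act a (extend (q, u) s) = extend (R.rule a q u) s)
    (w : List A) :
    w ∈ R.machine.language ↔ w.foldl (fun g a => act a * g) 1 ≠ 1 := by
  have hN := R.normal ⟨0, by omega⟩
  constructor
  · rintro ⟨C, D, hC, hrun, hD⟩ hw
    obtain ⟨q₀, x, z, rfl⟩ := R.isEntry_iff.1 hC
    have hres : R.machine.Result (R.readConfig q₀ x z q₀ [] 0) w D := by
      refine ⟨hrun, ?_⟩
      obtain ⟨q₀, q, b, h, -⟩ := hD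
      exact ⟨q₀, q, b, h⟩
    rcases word_run (R := R) hact q₀ x z w with ⟨q, p, j, h₁, -, h₂⟩ | ⟨-, h₂⟩
    · obtain rfl := hres.unique hN R.deterministic (result_readConfig h₂)
      rw [hw] at h₁
      obtain ⟨rfl, rfl, rfl⟩ := h₁.unique hn (q' := q₀) (p' := []) (j' := 0)
        ⟨by simp, .zero _ _, by simp⟩
      obtain ⟨q₁, q₂, b, h, h'⟩ := hD
      cases h
      simp at h'
    · exact hres.not_fails hN R.deterministic h₂
  · intro hw
    obtain ⟨⟨q₀, t⟩, ht⟩ : ∃ t, (w.foldl (fun g a => act a * g) 1) t ≠ t := by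
      by_contra! h
      exact hw (Equiv.ext h)
    -- The guess is the prefix of length `m + 1` of a point that is moved, long enough to exclude
    -- failure.
    set m := w.length * (R.window + R.bound) with hm
    have ht' : extend (q₀, t.take m ++ [t.get m]) (t.drop (m + 1)) = (q₀, t) := by
      have : t.take m ++ [t.get m] = t.take (m + 1) := by
        rw [Stream'.take_succ']
      rw [this]
      exact extend_take_drop (q₀, t) (m + 1)
    rcases word_run (R := R) hact q₀ (t.take m) (t.get m) w with
      ⟨q, p, j, h₁, -, h₂⟩ | ⟨h₁, -⟩
    · refine ⟨_, _, R.isEntry_readConfig q₀ _ _, h₂, q₀, q, _, rfl, ?_⟩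
      by_contra! hcon
      obtain ⟨rfl, hcon⟩ := hcon
      have h₀ : p = [] ∧ j = 0 := by
        simp only [ne_eq, decide_eq_true_eq, not_lt, Nat.le_zero, Nat.add_eq_zero_iff,
          List.length_eq_zero_iff] at hcon
        exact hcon
      obtain ⟨rfl, rfl⟩ := h₀
      refine ht ?_
      rw [← ht', h₁.map]
      simp
    · rw [Stream'.length_take] at h₁
      omega

theorem isSpecial [Nonempty A] (hn : 2 ≤ n)
    (hact : ∀ a q u s, u.length = R.window → act a (extend (q, u) s) = extend (R.rule a q u) s) :
    R.machine.IsSpecial where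
  normal := R.normal ⟨0, by omega⟩
  no_infinite := fun ⟨f, _, hf⟩ => R.no_infinite ⟨f, hf⟩
  progress := by
    intro D _ hD hf
    apply R.exists_step
    cases hs : D.state with
    | read q₀ q b => exact (hD ⟨q₀, q, b, hs⟩).elim
    | fail => exact (hf (hs ▸ R.isFail_fail)).elim
    | _ => rfl
  entry_reading := by
    rintro s _ ⟨-, q, rfl⟩
    exact ⟨q, q, false, rfl⟩
  deterministic := R.deterministic
  complete := by
    rintro D _ ⟨q₀, q, b, hs⟩ a
    apply R.exists_step
    rw [hs]
    rfl
  bounded D hD := (R.bounded hD).2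
  ignores := by
    intro C hC u v hv
    obtain ⟨q₀, x, z, rfl⟩ := R.isEntry_iff.1 hC
    rw [mem_language_iff hn hact, not_not] at hv
    -- Since `v` acts trivially, `u` and `u ++ v` give the same permutation, hence the same normal
    -- form.
    have huv : (u ++ v).foldl (fun g a => act a * g) 1 = u.foldl (fun g a => act a * g) 1 := by
      rw [List.foldl_append, foldl_mul, hv, one_mul]
    rcases word_run (R := R) hact q₀ x z u with ⟨q, p, j, h₁, -, h₂⟩ | ⟨-, h₂⟩
    · rcases word_run (R := R) hact q₀ x z (u ++ v) with ⟨q', p', j', h₃, -, h₄⟩ | ⟨-, h₄⟩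
      · rw [huv] at h₃
        obtain ⟨rfl, rfl, rfl⟩ := h₁.unique hn h₃
        exact .inl ⟨_, result_readConfig h₂, result_readConfig h₄⟩
      · exact .inr h₄
    · exact .inr (h₂.append v)

end PrefixRules

/-! ### Finitely generated groups of prefix replacements. -/

open HigmanThompson

/-- Prefix replacements of a finite family act on the prefixes of some common length. -/
theorem exists_prefixRules {A : Type} [Finite A] {n r : ℕ} (act : A → Equiv.Perm (Point n r))
    (h : ∀ a, act a ∈ higmanThompsonGroup n r) :
    ∃ R : PrefixRules A n r, ∀ a q u s, u.length = R.window →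
      act a (extend (q, u) s) = extend (R.rule a q u) s := by
  classical
  cases nonempty_fintype A
  choose N hN hact using fun a => (isPrefixReplacement_iff (act a)).1 (h a)
  let K := Finset.univ.sup N
  have hK (a : A) (x : Word n r) (hx : x.2.length = K) :
      ∃ y : Word n r, ∀ s, act a (extend x s) = extend y s := by
    have hle : N a ≤ K := Finset.le_sup (Finset.mem_univ a)
    obtain ⟨q, u⟩ := x
    obtain ⟨y, hy⟩ := hact a (q, u.take (N a)) (by simp at hx ⊢; omega)
    refine ⟨(y.1, y.2 ++ u.drop (N a)), fun s => ?_⟩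
    rw [← extend_extend, ← hy, extend_extend, List.take_append_drop]
  choose! y hy using hK
  have hfin : {x : A × Word n r | x.2.2.length = K}.Finite := by
    refine ((Set.finite_univ (α := A)).prod
      ((Set.finite_univ (α := Fin r)).prod (List.finite_length_eq (Fin n) K))).subset ?_
    intro x hx
    exact ⟨Set.mem_univ _, Set.mem_univ _, hx⟩
  -- Only finitely many pairs consist of a generator and a word of length `K`, so the lengths of the
  -- replacements have a supremum.
  refine ⟨⟨K, max K (hfin.toFinset.sup fun x => (y x.1 x.2).2.length), le_max_left _ _,
    fun a q u => y a (q, u), fun a q u hu => ?_⟩, fun a q u s hu => hy a (q, u) hu s⟩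
  exact le_max_of_le_right (Finset.le_sup (f := fun x : A × Word n r => (y x.1 x.2).2.length)
    (b := (a, (q, u))) (hfin.mem_toFinset.2 hu))

/-- Finitely generated groups of prefix replacements are special co-ET0L groups. -/
theorem isSpecialCoET0L_of_closure {n r : ℕ} (hn : 2 ≤ n) {H : Subgroup (Equiv.Perm (Point n r))}
    (hH : H ≤ higmanThompsonGroup n r) {S : Set (Equiv.Perm (Point n r))} (hS : S.Finite)
    (hSH : Subgroup.closure S = H) : IsSpecialCoET0L H := by
  -- The identity is included to make the alphabet nonempty.
  let T : Set (Equiv.Perm (Point n r)) := insert 1 (S ∪ S⁻¹)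
  have hT : T.Finite := (hS.union hS.inv).insert 1
  have hTH : Subgroup.closure T = H := by
    rw [Subgroup.closure_insert_one, Subgroup.closure_union, Subgroup.closure_inv, sup_idem, hSH]
  have hinv (a : Equiv.Perm (Point n r)) (ha : a ∈ T) : a⁻¹ ∈ T := by
    rcases ha with rfl | ha | ha
    · exact .inl inv_one
    · exact .inr (.inr (by simpa using ha))
    · exact .inr (.inl ha)
  have h1 : (1 : Equiv.Perm (Point n r)) ∈ T := .inl rfl
  clear_value T
  subst hTH
  let B : Set (Subgroup.closure T) := (↑) ⁻¹' T
  have hB : B.Finite := hT.preimage Subtype.val_injective.injOn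
  have : Finite B := hB
  have : Nonempty B := ⟨⟨1, h1⟩⟩
  -- The machine applies the first input letter first, whereas in a product of permutations the last
  -- factor acts first. With inverses the machine computes the inverse of the product.
  let act (a : B) : Equiv.Perm (Point n r) := ((a : Subgroup.closure T) : Equiv.Perm (Point n r))⁻¹
  obtain ⟨R, hR⟩ := exists_prefixRules act fun a => inv_mem (hH (a : Subgroup.closure T).2)
  have hfold (w : List B) : w.foldl (fun g a => act a * g) 1 =
      (((w.map (fun a : B => (a : Subgroup.closure T))).prod : Subgroup.closure T) :
        Equiv.Perm (Point n r))⁻¹ := by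
    induction w with
    | nil => simp
    | cons a w ih =>
      rw [List.foldl_cons, PrefixRules.foldl_mul, ih]
      simp [act]
  refine ⟨B, hB, fun a ha => hinv _ ha, Subgroup.closure_closure_coe_preimage, R.machine,
    PrefixRules.isSpecial hn hR, ?_⟩
  ext w
  rw [PrefixRules.mem_language_iff hn hR, hfold, ne_eq, inv_eq_one, OneMemClass.coe_eq_one]
  rfl

/-! ## Subdivisions -/

namespace HigmanThompson

variable {n r : ℕ}

/-- Neither word is a prefix of the other. -/
def Incomparable (b c : Word n r) : Prop :=
  b.1 = c.1 → ¬ b.2 <+: c.2 ∧ ¬ c.2 <+: b.2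

theorem Incomparable.symm {b c : Word n r} (h : Incomparable b c) : Incomparable c b :=
  fun e => (h e.symm).symm

theorem not_incomparable {b c : Word n r} (h : ¬ Incomparable b c) :
    (∃ m, c = (b.1, b.2 ++ m)) ∨ ∃ m, b = (c.1, c.2 ++ m) := by
  obtain ⟨i, l⟩ := b
  obtain ⟨j, m⟩ := c
  simp only [Incomparable, Classical.not_imp, not_and_or, not_not] at h
  obtain ⟨rfl, ⟨t, rfl⟩ | ⟨t, rfl⟩⟩ := h
  · exact .inl ⟨t, rfl⟩
  · exact .inr ⟨t, rfl⟩

theorem Incomparable.extend_ne {b c : Word n r} (h : Incomparable b c) (s t : Stream' (Fin n)) :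
    extend b s ≠ extend c t := by
  intro e
  obtain ⟨i, l⟩ := b
  obtain ⟨j, m⟩ := c
  rcases le_total l.length m.length with hl | hl
  · obtain ⟨m', hm'⟩ := prefix_of_extend_eq (b := (i, l)) hl e
    obtain ⟨rfl, rfl⟩ := Prod.mk.inj hm'
    exact (h rfl).1 (List.prefix_append _ _)
  · obtain ⟨m', hm'⟩ := prefix_of_extend_eq (b := (j, m)) hl e.symm
    obtain ⟨rfl, rfl⟩ := Prod.mk.inj hm'
    exact (h rfl).2 (List.prefix_append _ _)

theorem incomparable_of_extend_ne [Nonempty (Fin n)] {b c : Word n r}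
    (h : ∀ s t, extend b s ≠ extend c t) : Incomparable b c := by
  obtain ⟨a⟩ := ‹Nonempty (Fin n)›
  by_contra hc
  rcases not_incomparable hc with ⟨m, rfl⟩ | ⟨m, rfl⟩
  · exact h (m ++ₛ Stream'.const a) (Stream'.const a) (extend_extend _ _ _ _)
  · exact h (Stream'.const a) (m ++ₛ Stream'.const a) (extend_extend _ _ _ _).symm

/-- The words obtained from `b` by appending one letter. -/
def children (b : Word n r) : List (Word n r) :=
  (List.finRange n).map fun i => (b.1, b.2 ++ [i])

@[simp] theorem length_children (b : Word n r) : (children b).length = n := by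
  simp [children]

theorem mem_children {b c : Word n r} : c ∈ children b ↔ ∃ i, c = (b.1, b.2 ++ [i]) := by
  simp [children, eq_comm]

/-- The lists, in lexicographic order, of the elements of finite complete antichains. -/
inductive IsSubdivision : List (Word n r) → Prop
  | roots : IsSubdivision ((List.finRange r).map fun q => (q, []))
  | expand {l₁ : List (Word n r)} {b : Word n r} {l₂ : List (Word n r)} :
      IsSubdivision (l₁ ++ b :: l₂) → IsSubdivision (l₁ ++ (children b ++ l₂))

theorem pairwise_map_finRange {α : Type*} {m : ℕ} {P : α → α → Prop} {f : Fin m → α}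
    (h : ∀ i j, i < j → P (f i) (f j)) : ((List.finRange m).map f).Pairwise P := by
  rw [List.pairwise_map]
  exact (List.pairwise_lt_finRange m).imp fun {i j} hij => h i j hij

/-- A relation between words that passes to extensions of words holds between the elements of
subdivisions. -/
theorem IsSubdivision.pairwise {P : Word n r → Word n r → Prop}
    (hroots : ∀ i j : Fin r, i < j → P (i, []) (j, []))
    (hchild : ∀ (b : Word n r) (i j : Fin n), i < j → P (b.1, b.2 ++ [i]) (b.1, b.2 ++ [j]))
    (hleft : ∀ (b c : Word n r) (i : Fin n), P b c → P (b.1, b.2 ++ [i]) c)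
    (hright : ∀ (b c : Word n r) (i : Fin n), P b c → P b (c.1, c.2 ++ [i]))
    {l : List (Word n r)} (hl : IsSubdivision l) : l.Pairwise P := by
  induction hl with
  | roots => exact pairwise_map_finRange fun i j hij => hroots i j hij
  | @expand l₁ b l₂ _ ih =>
    simp only [List.pairwise_append, List.pairwise_cons, List.mem_cons, List.mem_append] at ih ⊢
    obtain ⟨h₁, ⟨h₂, h₃⟩, h₄⟩ := ih
    refine ⟨h₁, ⟨pairwise_map_finRange fun i j hij => hchild b i j hij, h₃, ?_⟩, ?_⟩
    · intro c hc d hd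
      obtain ⟨i, rfl⟩ := mem_children.1 hc
      exact hleft b d i (h₂ d hd)
    · rintro c hc d (hd | hd)
      · obtain ⟨i, rfl⟩ := mem_children.1 hd
        exact hright c b i (h₄ c hc b (.inl rfl))
      · exact h₄ c hc d (.inr hd)

/-- Two prefixes of the same word are comparable. -/
theorem incomparable_append_left {b c : Word n r} (h : Incomparable b c) (m : List (Fin n)) :
    Incomparable (b.1, b.2 ++ m) c := by
  intro e
  refine ⟨fun h' => (h e).1 ((List.prefix_append _ _).trans h'), fun h' => ?_⟩
  exact (List.prefix_or_prefix_of_prefix h' (List.prefix_append _ _)).elim (h e).2 (h e).1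

theorem IsSubdivision.incomparable {l : List (Word n r)} (hl : IsSubdivision l) :
    l.Pairwise Incomparable := by
  refine hl.pairwise ?_ ?_ (fun b c i h => incomparable_append_left h _)
    (fun b c i (h : Incomparable b c) => (incomparable_append_left h.symm [i]).symm)
  · intro i j hij h
    exact (hij.ne h).elim
  · intro b i j hij _
    constructor
    · intro h
      have := h.eq_of_length (by simp)
      simp at this
      exact hij.ne this
    · intro h
      have := h.eq_of_length (by simp)
      simp at this
      exact hij.ne' this

theorem IsSubdivision.exists_extend {l : List (Word n r)} (hl : IsSubdivision l)
    (p : Point n r) : ∃ b ∈ l, ∃ s, p = extend b s := by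
  induction hl with
  | roots => exact ⟨(p.1, []), by simp, p.2, rfl⟩
  | @expand l₁ b l₂ _ ih =>
    obtain ⟨c, hc, s, hs⟩ := ih
    simp only [List.mem_append, List.mem_cons] at hc ⊢
    rcases hc with hc | rfl | hc
    · exact ⟨c, .inl hc, s, hs⟩
    · refine ⟨_, .inr (.inl (mem_children.2 ⟨s.head, rfl⟩)), s.tail, ?_⟩
      rw [hs, ← extend_extend]
      simp [extend, Stream'.eta]
    · exact ⟨c, .inr (.inr hc), s, hs⟩

theorem Incomparable.irrefl (b : Word n r) : ¬ Incomparable b b :=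
  fun h => (h rfl).1 List.prefix_rfl

theorem nodup_of_pairwise_incomparable {l : List (Word n r)} (hl : l.Pairwise Incomparable) :
    l.Nodup :=
  List.Pairwise.imp (S := (· ≠ ·)) (fun {b c} h e => Incomparable.irrefl b (by rwa [← e] at h)) hl

/-- Every finite complete antichain is listed by a subdivision. -/
theorem IsCompleteAntichain.exists_isSubdivision (hn : 2 ≤ n) {B : Finset (Word n r)}
    (hB : IsCompleteAntichain B) : ∃ l, IsSubdivision l ∧ ∀ b, b ∈ l ↔ b ∈ B := by
  classical
  obtain ⟨a⟩ : Nonempty (Fin n) := ⟨⟨0, by omega⟩⟩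
  induction hk : B.card using Nat.strong_induction_on generalizing B with
  | _ k ih =>
  subst hk
  have huniq {b c : Word n r} (hb : b ∈ B) (hc : c ∈ B) {s t : Stream' (Fin n)}
      (h : extend b s = extend c t) : b = c :=
    (hB (extend b s)).unique ⟨hb, s, rfl⟩ ⟨hc, t, h⟩
  by_cases h₀ : ∀ b ∈ B, b.2 = []
  · refine ⟨_, .roots, fun b => ?_⟩
    simp only [List.mem_map, List.mem_finRange, true_and]
    constructor
    · rintro ⟨q, rfl⟩
      obtain ⟨c, ⟨hc, s, hs⟩, -⟩ := hB (extend (q, []) (Stream'.const a))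
      have h₁ : q = c.1 := congrArg Prod.fst hs
      have h₂ := h₀ c hc
      rwa [h₁, ← h₂]
    · intro hb
      exact ⟨b.1, by rw [← h₀ b hb]⟩
  push Not at h₀
  obtain ⟨b₀, hb₀, hne⟩ := h₀
  -- A longest word of `B` has the form `z` followed by a letter. Each child of `z` must then lie in
  -- `B`: a shorter prefix of it would also be a prefix of the longest word. Contracting the
  -- children to `z` gives a smaller antichain.
  obtain ⟨b, hb, hmax⟩ := B.exists_max_image (fun b => b.2.length) ⟨b₀, hb₀⟩
  have hbne : b.2 ≠ [] := by
    intro h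
    have := hmax b₀ hb₀
    rw [h] at this
    exact hne (List.length_eq_zero_iff.1 (by simpa using this))
  obtain ⟨z, c, rfl⟩ : ∃ (z : Word n r) (c : Fin n), b = (z.1, z.2 ++ [c]) :=
    ⟨(b.1, b.2.dropLast), b.2.getLast hbne, by rw [List.dropLast_append_getLast]⟩
  simp only [List.length_append, List.length_singleton] at hmax
  have hchild (i : Fin n) : (z.1, z.2 ++ [i]) ∈ B := by
    obtain ⟨d, ⟨hd, s, hs⟩, -⟩ := hB (extend (z.1, z.2 ++ [i]) (Stream'.const a))
    have hle := hmax d hd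
    rcases hle.lt_or_eq with hlt | heq
    · rw [← extend_extend] at hs
      obtain ⟨m', hm'⟩ := prefix_of_extend_eq (b := d) (i := z.1) (m := z.2) (by omega) hs.symm
      have : extend d (m' ++ₛ ([c] ++ₛ Stream'.const a)) =
          extend (z.1, z.2 ++ [c]) (Stream'.const a) := by
        change extend (d.1, d.2) _ = _
        rw [extend_extend, ← hm', extend_extend]
      have := huniq hd hb this
      rw [this] at hlt
      simp at hlt
    · rwa [eq_of_extend_eq (by simp [heq]) hs]
  have hsub : (children z).toFinset ⊆ B := by
    intro d hd
    obtain ⟨i, rfl⟩ := mem_children.1 (List.mem_toFinset.1 hd)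
    exact hchild i
  have hnodup : (children z).Nodup := by
    refine (List.nodup_finRange n).map ?_
    intro i j hij
    simpa using hij
  have hcard : (children z).toFinset.card = n := by
    rw [List.toFinset_card_of_nodup hnodup, length_children]
  set B' := insert z (B \ (children z).toFinset) with hB'
  have hz (p : Point n r) (s) (hs : p = extend z s) :
      p = extend (z.1, z.2 ++ [s.head]) s.tail := by
    rw [hs, ← extend_extend]
    simp [extend, Stream'.eta]
  have hzB : z ∉ B := by
    intro h
    have := huniq h (hchild c) (hz _ (Stream'.const c) rfl)
    have := congrArg (fun w : Word n r => w.2.length) this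
    simp at this
  have hB'c : IsCompleteAntichain B' := by
    intro p
    obtain ⟨d, ⟨hd, s, hs⟩, hd'⟩ := hB p
    by_cases hdz : d ∈ children z
    · obtain ⟨i, rfl⟩ := mem_children.1 hdz
      refine ⟨z, ⟨Finset.mem_insert_self _ _, [i] ++ₛ s, by rw [hs, ← extend_extend]⟩, ?_⟩
      rintro e ⟨he, t, ht⟩
      rcases Finset.mem_insert.1 he with rfl | he
      · rfl
      · obtain ⟨he, he'⟩ := Finset.mem_sdiff.1 he
        obtain rfl := hd' e ⟨he, t, ht⟩
        exact (he' (List.mem_toFinset.2 hdz)).elim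
    · refine ⟨d, ⟨Finset.mem_insert_of_mem (Finset.mem_sdiff.2 ⟨hd, by simpa using hdz⟩), s, hs⟩,
        ?_⟩
      rintro e ⟨he, t, ht⟩
      rcases Finset.mem_insert.1 he with rfl | he
      · have := hd' _ ⟨hchild t.head, t.tail, hz p t ht⟩
        exact (hdz (mem_children.2 ⟨_, this.symm⟩)).elim
      · exact hd' e ⟨(Finset.mem_sdiff.1 he).1, t, ht⟩
  -- The cardinality drops by `n - 1`, which is positive.
  have hlt : B'.card < B.card := by
    rw [hB', Finset.card_insert_of_notMem (fun h => hzB (Finset.mem_sdiff.1 h).1),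
      Finset.card_sdiff_of_subset hsub, hcard]
    have := Finset.card_le_card hsub
    omega
  obtain ⟨l, hl, hmem⟩ := ih _ hlt hB'c rfl
  obtain ⟨l₁, l₂, rfl⟩ := List.append_of_mem ((hmem z).2 (Finset.mem_insert_self _ _))
  refine ⟨_, .expand hl, fun d => ?_⟩
  have hnd := nodup_of_pairwise_incomparable hl.incomparable
  have h₁ := hmem d
  simp only [hB', List.mem_append, List.mem_cons, Finset.mem_insert, Finset.mem_sdiff,
    List.mem_toFinset] at h₁ ⊢
  have h₂ : d ∈ children z → d ∈ B := fun h => hsub (List.mem_toFinset.2 h)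
  have h₃ : d = z → ¬ (d ∈ l₁ ∨ d ∈ l₂) := by
    rintro rfl
    rw [List.nodup_middle, List.nodup_cons, List.mem_append] at hnd
    exact hnd.1
  have h₄ : d = z → d ∉ B := by
    rintro rfl
    exact hzB
  tauto

/-! ### Permutations that carry one list of words to another. -/

/-- The permutation `f` replaces the prefixes in the first list by those in the second list. -/
def Carries (f : Equiv.Perm (Point n r)) (l l' : List (Word n r)) : Prop :=
  List.Forall₂ (fun b c => ∀ s, f (extend b s) = extend c s) l l'

theorem Carries.one (l : List (Word n r)) : Carries 1 l l :=
  List.forall₂_same.2 fun _ _ _ => rfl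

theorem Carries.mul {f g : Equiv.Perm (Point n r)} {l l' l'' : List (Word n r)}
    (hg : Carries g l' l'') (hf : Carries f l l') : Carries (g * f) l l'' := by
  unfold Carries at *
  induction hf generalizing l'' with
  | nil => cases hg; exact .nil
  | cons h _ ih =>
    cases hg with
    | cons h' hg => exact .cons (fun s => by rw [Equiv.Perm.mul_apply, h, h']) (ih hg)

theorem Carries.children {f : Equiv.Perm (Point n r)} {b c : Word n r}
    (h : ∀ s, f (extend b s) = extend c s) : Carries f (children b) (children c) := by
  unfold Carries HigmanThompson.children
  rw [List.forall₂_map_left_iff, List.forall₂_map_right_iff, List.forall₂_same]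
  intro i _ s
  rw [← extend_extend, h, extend_extend]

/-- The cones of a subdivision cover all points. -/
theorem Carries.eq {f g : Equiv.Perm (Point n r)} {l l' : List (Word n r)}
    (hf : Carries f l l') (hg : Carries g l l') (hl : IsSubdivision l) : f = g := by
  have key : ∀ b ∈ l, ∀ s, f (extend b s) = g (extend b s) := by
    clear hl
    unfold Carries at hf hg
    induction hf with
    | nil => simp
    | cons h _ ih =>
      cases hg with
      | cons h' hg =>
        intro b hb s
        rcases List.mem_cons.1 hb with rfl | hb
        · rw [h, h']
        · exact ih hg b hb s
  ext1 p
  obtain ⟨b, hb, s, rfl⟩ := hl.exists_extend p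
  exact key b hb s

/-- An element of the Higman-Thompson group carries some subdivision to the elements of a complete
antichain, listed in some order. -/
theorem exists_carries (hn : 2 ≤ n) {f : Equiv.Perm (Point n r)}
    (hf : f ∈ higmanThompsonGroup n r) :
    ∃ l l' m, IsSubdivision l ∧ IsSubdivision m ∧ Carries f l l' ∧ l'.Perm m := by
  obtain ⟨B, C, hB, hC, φ, hφ⟩ := hf
  obtain ⟨l, hl, hlB⟩ := hB.exists_isSubdivision hn
  obtain ⟨m, hm, hmC⟩ := hC.exists_isSubdivision hn
  let ψ (b : {b // b ∈ l}) : Word n r := φ ⟨b.1, (hlB b.1).1 b.2⟩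
  have hψ : Function.Injective ψ := by
    intro b c h
    have := φ.injective (Subtype.ext h)
    exact Subtype.ext (congrArg Subtype.val this :)
  refine ⟨l, l.attach.map ψ, m, hl, hm, ?_, ?_⟩
  · unfold Carries
    rw [List.forall₂_map_right_iff]
    conv => arg 2; rw [← List.attach_map_subtype_val l]
    rw [List.forall₂_map_left_iff, List.forall₂_same]
    intro b _ s
    exact hφ ⟨b.1, (hlB b.1).1 b.2⟩ s
  · rw [List.perm_ext_iff_of_nodup
      ((List.nodup_attach.2 (nodup_of_pairwise_incomparable hl.incomparable)).map hψ)
      (nodup_of_pairwise_incomparable hm.incomparable)]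
    intro c
    rw [hmC, List.mem_map]
    constructor
    · rintro ⟨b, -, rfl⟩
      exact (φ _).2
    · intro hc
      refine ⟨⟨(φ.symm ⟨c, hc⟩ : Word n r), (hlB _).2 (φ.symm ⟨c, hc⟩).2⟩, List.mem_attach _ _, ?_⟩
      simp [ψ]

/-! ## Generators of the Higman-Thompson groups -/

/-- The permutation `f` exchanges the prefixes `b` and `c` and fixes all points with neither. -/
structure IsConeSwap (f : Equiv.Perm (Point n r)) (b c : Word n r) : Prop where
  left : ∀ s, f (extend b s) = extend c s
  right : ∀ s, f (extend c s) = extend b s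
  fixed : ∀ p, (∀ s, p ≠ extend b s) → (∀ s, p ≠ extend c s) → f p = p

theorem IsConeSwap.symm {f : Equiv.Perm (Point n r)} {b c : Word n r} (h : IsConeSwap f b c) :
    IsConeSwap f c b :=
  ⟨h.right, h.left, fun p h₁ h₂ => h.fixed p h₂ h₁⟩

theorem IsConeSwap.fixed_extend {f : Equiv.Perm (Point n r)} {b c d : Word n r}
    (h : IsConeSwap f b c) (hb : Incomparable b d) (hc : Incomparable c d)
    (s : Stream' (Fin n)) : f (extend d s) = extend d s :=
  h.fixed _ (fun _ => hb.symm.extend_ne _ _) fun _ => hc.symm.extend_ne _ _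

theorem IsConeSwap.unique {f g : Equiv.Perm (Point n r)} {b c : Word n r}
    (hf : IsConeSwap f b c) (hg : IsConeSwap g b c) : f = g := by
  ext1 p
  by_cases hb : ∃ s, p = extend b s
  · obtain ⟨s, rfl⟩ := hb
    rw [hf.left, hg.left]
  by_cases hc : ∃ s, p = extend c s
  · obtain ⟨s, rfl⟩ := hc
    rw [hf.right, hg.right]
  push Not at hb hc
  rw [hf.fixed p hb hc, hg.fixed p hb hc]

theorem extend_stream_injective (b : Word n r) : Function.Injective (extend b) := by
  intro s t h
  exact Stream'.append_right_injective b.2 s t (congrArg Prod.snd h)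

theorem exists_isConeSwap {b c : Word n r} (h : Incomparable b c) : ∃ f, IsConeSwap f b c := by
  classical
  let F (p : Point n r) : Point n r :=
    if hb : ∃ s, p = extend b s then extend c hb.choose
    else if hc : ∃ s, p = extend c s then extend b hc.choose else p
  have h₁ (s) : F (extend b s) = extend c s := by
    have hb : ∃ t, extend b s = extend b t := ⟨s, rfl⟩
    simp only [F, dif_pos hb]
    rw [← extend_stream_injective b hb.choose_spec]
  have h₂ (s) : F (extend c s) = extend b s := by
    have hb : ¬ ∃ t, extend c s = extend b t := fun ⟨t, ht⟩ => h.extend_ne t s ht.symm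
    have hc : ∃ t, extend c s = extend c t := ⟨s, rfl⟩
    simp only [F, dif_neg hb, dif_pos hc]
    rw [← extend_stream_injective c hc.choose_spec]
  have h₃ (p) (hb : ¬ ∃ s, p = extend b s) (hc : ¬ ∃ s, p = extend c s) : F p = p := by
    simp only [F, dif_neg hb, dif_neg hc]
  have hF : Function.Involutive F := by
    intro p
    by_cases hb : ∃ s, p = extend b s
    · obtain ⟨s, rfl⟩ := hb
      rw [h₁, h₂]
    by_cases hc : ∃ s, p = extend c s
    · obtain ⟨s, rfl⟩ := hc
      rw [h₂, h₁]
    rw [h₃ p hb hc, h₃ p hb hc]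
  exact ⟨hF.toPerm, h₁, h₂, fun p hb hc => h₃ p (by simpa using hb) (by simpa using hc)⟩

theorem IsConeSwap.conj {f h : Equiv.Perm (Point n r)} {b c b' c' : Word n r}
    (hf : IsConeSwap f b c) (hb : ∀ s, h (extend b s) = extend b' s)
    (hc : ∀ s, h (extend c s) = extend c' s) : IsConeSwap (h * f * h⁻¹) b' c' := by
  have hb' (s) : h⁻¹ (extend b' s) = extend b s := by rw [Equiv.Perm.inv_eq_iff_eq, hb]
  have hc' (s) : h⁻¹ (extend c' s) = extend c s := by rw [Equiv.Perm.inv_eq_iff_eq, hc]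
  have hinv (p) : h (h⁻¹ p) = p := h.apply_symm_apply p
  refine ⟨fun s => ?_, fun s => ?_, fun p h₁ h₂ => ?_⟩
  · simp only [Equiv.Perm.mul_apply, hb', hf.left, hc]
  · simp only [Equiv.Perm.mul_apply, hc', hf.right, hb]
  · have : f (h⁻¹ p) = h⁻¹ p := by
      apply hf.fixed
      · intro s hs
        exact h₁ s (by rw [← hb, ← hs, hinv])
      · intro s hs
        exact h₂ s (by rw [← hc, ← hs, hinv])
    simp only [Equiv.Perm.mul_apply, this, hinv]

/-- A word longer than both `b` and `c` either extends one of them or is incomparable to both, so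
each such cone is moved by a prefix replacement. -/
theorem IsConeSwap.mem_higmanThompsonGroup {f : Equiv.Perm (Point n r)} {b c : Word n r}
    (hf : IsConeSwap f b c) : f ∈ higmanThompsonGroup n r := by
  refine (isPrefixReplacement_iff f).2 ⟨max b.2.length c.2.length + 1, by omega, fun x hx => ?_⟩
  have key {d e : Word n r} (hd : d.2.length < x.2.length)
      (hf : ∀ s, f (extend d s) = extend e s) (h : ¬ Incomparable d x) :
      ∃ y : Word n r, ∀ s, f (extend x s) = extend y s := by
    rcases not_incomparable h with ⟨m, rfl⟩ | ⟨m, rfl⟩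
    · exact ⟨(e.1, e.2 ++ m), fun s => by rw [← extend_extend, hf, extend_extend]⟩
    · simp at hd
  by_cases hb : Incomparable b x
  · by_cases hc : Incomparable c x
    · exact ⟨x, hf.fixed_extend hb hc⟩
    · exact key (by omega) hf.right hc
  · exact key (by omega) hf.left hb

/-! ### Short swaps generate. -/

/-- The swaps of prefixes of length at most three. -/
def shortSwaps (n r : ℕ) : Set (Equiv.Perm (Point n r)) :=
  {f | ∃ b c : Word n r, b.2.length ≤ 3 ∧ c.2.length ≤ 3 ∧ Incomparable b c ∧ IsConeSwap f b c}

theorem finite_shortSwaps (n r : ℕ) : (shortSwaps n r).Finite := by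
  have hfin : {b : Word n r | b.2.length ≤ 3}.Finite := by
    refine ((Set.finite_univ (α := Fin r)).prod (List.finite_length_le (Fin n) 3)).subset ?_
    intro b hb
    exact ⟨Set.mem_univ _, hb⟩
  refine (hfin.biUnion fun b _ => hfin.biUnion (t := fun c => {f | IsConeSwap f b c})
    fun c _ => ?_).subset ?_
  · exact Set.Subsingleton.finite fun f hf g hg => hf.unique hg
  · rintro f ⟨b, c, hb, hc, -, hf⟩
    exact Set.mem_biUnion hb (Set.mem_biUnion hc hf)

/-- A word of length two that is incomparable to two given incomparable words, the first of which
is long. -/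
theorem exists_incomparable (hn : 2 ≤ n) {b c : Word n r} (hb : 3 < b.2.length)
    (hbc : Incomparable b c) :
    ∃ d : Word n r, d.2.length = 2 ∧ Incomparable (b.1, b.2.take 3) d ∧ Incomparable d c := by
  have : Nontrivial (Fin n) := Fin.nontrivial_iff_two_le.2 hn
  obtain ⟨q, l⟩ := b
  obtain ⟨q', m⟩ := c
  obtain _ | ⟨x₀, _ | ⟨x₁, _ | ⟨x₂, l⟩⟩⟩ := l
  iterate 3 simp at hb
  obtain ⟨y₀, hy₀⟩ := exists_ne x₀
  obtain ⟨y₁, hy₁⟩ := exists_ne x₁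
  -- If the second word has at most one letter, incomparability already separates the words at the
  -- root or at the first letter, and it suffices to change the second letter of the first word.
  -- Otherwise the new word differs from the first word in its first letter and from the other in
  -- its second letter.
  rcases m with _ | ⟨z₀, _ | ⟨z₁, m⟩⟩
  · refine ⟨(q, [x₀, y₁]), rfl, ?_, ?_⟩
    · simp [Incomparable, hy₁, hy₁.symm]
    · intro h
      exact ((hbc h).2 List.nil_prefix).elim
  · refine ⟨(q, [x₀, y₁]), rfl, ?_, ?_⟩
    · simp [Incomparable, hy₁, hy₁.symm]
    · simp [Incomparable] at hbc ⊢
      grind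
  · obtain ⟨y, hy⟩ := exists_ne z₁
    refine ⟨(q, [y₀, y]), rfl, ?_, ?_⟩
    · simp [Incomparable, hy₀, hy₀.symm]
    · simp [Incomparable, hy, hy.symm]

/-- Conjugation by the short swap of `b.take 3` with a word `d` of length two shortens `b` by one
letter and does not lengthen `c`. The conjugate is a swap of smaller total length. -/
theorem IsConeSwap.mem_closure (hn : 2 ≤ n) {f : Equiv.Perm (Point n r)} {b c : Word n r}
    (hbc : Incomparable b c) (hf : IsConeSwap f b c) : f ∈ Subgroup.closure (shortSwaps n r) := by
  induction hk : b.2.length + c.2.length using Nat.strong_induction_on generalizing f b c with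
  | _ k ih =>
  by_cases hshort : b.2.length ≤ 3 ∧ c.2.length ≤ 3
  · exact Subgroup.subset_closure ⟨b, c, hshort.1, hshort.2, hbc, hf⟩
  wlog hb : 3 < b.2.length generalizing b c
  · exact this hbc.symm hf.symm (by omega) (by omega) (by omega)
  obtain ⟨d, hd, hbd, hdc⟩ := exists_incomparable hn hb hbc
  obtain ⟨h, hh⟩ := exists_isConeSwap hbd
  have hmem : h ∈ Subgroup.closure (shortSwaps n r) :=
    Subgroup.subset_closure ⟨_, d, by simp, by omega, hbd, hh⟩
  have hhb (s) : h (extend b s) = extend (d.1, d.2 ++ b.2.drop 3) s := by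
    have := hh.left (b.2.drop 3 ++ₛ s)
    rw [extend_extend, List.take_append_drop] at this
    rw [← extend_extend]
    exact this
  obtain ⟨c', hc', hhc⟩ : ∃ c' : Word n r, c'.2.length ≤ c.2.length ∧
      ∀ s, h (extend c s) = extend c' s := by
    by_cases hcb : Incomparable (b.1, b.2.take 3) c
    · exact ⟨c, le_rfl, hh.fixed_extend hcb hdc⟩
    · rcases not_incomparable hcb with ⟨m, rfl⟩ | ⟨m, hm⟩
      · refine ⟨(d.1, d.2 ++ m), by simp; omega, fun s => ?_⟩
        have := hh.left (m ++ₛ s)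
        rw [extend_extend] at this
        exact this.trans (extend_extend d.1 d.2 m s)
      · obtain ⟨h₁, h₂⟩ := Prod.mk.inj hm
        refine ((hbc h₁).2 ?_).elim
        rw [← List.take_append_drop 3 b.2, h₂, List.append_assoc]
        exact List.prefix_append _ _
  have hf' := hf.conj hhb hhc
  have hinc : Incomparable (d.1, d.2 ++ b.2.drop 3) c' := by
    have : Nonempty (Fin n) := ⟨⟨0, by omega⟩⟩
    refine incomparable_of_extend_ne fun s t e => ?_
    rw [← hhb, ← hhc] at e
    exact hbc.extend_ne _ _ (h.injective e)
  have hrec := ih _ (by simp; omega) hinc hf' rfl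
  have := mul_mem (mul_mem (inv_mem hmem) hrec) hmem
  simpa [mul_assoc] using this

/-- Adjacent transpositions are cone swaps. The clause on cones outside the list lets the induction
add an element at the front. -/
theorem exists_carries_of_perm (hn : 2 ≤ n) {l l' : List (Word n r)} (h : l.Perm l')
    (hl : l.Pairwise Incomparable) :
    ∃ f ∈ Subgroup.closure (shortSwaps n r), Carries f l l' ∧
      ∀ c, (∀ b ∈ l, Incomparable b c) → ∀ s, f (extend c s) = extend c s := by
  induction h with
  | nil => exact ⟨1, one_mem _, .nil, fun _ _ _ => rfl⟩
  | cons b _ ih =>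
    rw [List.pairwise_cons] at hl
    obtain ⟨f, hf, h₁, h₂⟩ := ih hl.2
    refine ⟨f, hf, .cons (h₂ b fun c hc => (hl.1 c hc).symm) h₁, fun c hc => h₂ c fun d hd => ?_⟩
    exact hc d (List.mem_cons_of_mem _ hd)
  | swap b c l =>
    simp only [List.pairwise_cons, List.mem_cons, forall_eq_or_imp] at hl
    obtain ⟨⟨hcb, hc⟩, hb, -⟩ := hl
    obtain ⟨f, hf⟩ := exists_isConeSwap hcb
    refine ⟨f, hf.mem_closure hn hcb, .cons hf.left (.cons hf.right ?_), fun d hd => ?_⟩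
    · exact List.forall₂_same.2 fun d hd => hf.fixed_extend (hc d hd) (hb d hd)
    · exact hf.fixed_extend (hd c (by simp)) (hd b (by simp))
  | trans h₁ _ ih₁ ih₂ =>
    obtain ⟨f, hf, h₂, h₃⟩ := ih₁ hl
    obtain ⟨g, hg, h₄, h₅⟩ := ih₂ (h₁.pairwise hl fun h => h.symm)
    refine ⟨g * f, mul_mem hg hf, h₄.mul h₂, fun c hc s => ?_⟩
    rw [Equiv.Perm.mul_apply, h₃ c hc, h₅ c fun b hb => hc b (h₁.mem_iff.2 hb)]

/-- The subdivision obtained from the trivial one by `k` times expanding the first element. -/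
def standard (n r : ℕ) : ℕ → List (Word n r)
  | 0 => (List.finRange r).map fun q => (q, [])
  | k + 1 => match standard n r k with
    | [] => []
    | b :: l => children b ++ l

/-- To follow an expansion of `b`, first reorder so that `b` is carried to the first standard word;
then its children go to the children of that word. The length determines `k`. -/
theorem IsSubdivision.exists_carries_standard (hn : 2 ≤ n) {l : List (Word n r)}
    (hl : IsSubdivision l) : ∃ k, l.length = r + k * (n - 1) ∧ ∀ l', l'.Perm l →
      ∃ f ∈ Subgroup.closure (shortSwaps n r), Carries f l' (standard n r k) := by
  suffices h : ∃ k, l.length = r + k * (n - 1) ∧ ∃ l', l'.Perm l ∧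
      ∃ f ∈ Subgroup.closure (shortSwaps n r), Carries f l' (standard n r k) by
    obtain ⟨k, hk, l', hl', f, hf, hc⟩ := h
    refine ⟨k, hk, fun l'' hl'' => ?_⟩
    obtain ⟨g, hg, hgc, -⟩ := exists_carries_of_perm hn (hl''.trans hl'.symm)
      (hl''.symm.pairwise hl.incomparable fun h => h.symm)
    exact ⟨f * g, mul_mem hf hg, hc.mul hgc⟩
  induction hl with
  | roots => exact ⟨0, by simp, _, .rfl, 1, one_mem _, .one _⟩
  | @expand l₁ b l₂ hl ih =>
    obtain ⟨k, hk, l', hl', f, hf, hc⟩ := ih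
    have hperm : (b :: (l₁ ++ l₂)).Perm l' := (List.perm_middle.symm.trans hl'.symm)
    obtain ⟨g, hg, hgc, -⟩ := exists_carries_of_perm hn hperm
      ((List.perm_middle (l₁ := l₁)).pairwise hl.incomparable fun h => h.symm)
    refine ⟨k + 1, ?_, children b ++ (l₁ ++ l₂), ?_, f * g, mul_mem hf hg, ?_⟩
    · simp only [List.length_append, List.length_cons, length_children] at hk ⊢
      rw [add_mul]
      omega
    · rw [← List.append_assoc, ← List.append_assoc]
      exact List.perm_append_comm.append_right l₂
    · have h := hc.mul hgc
      rw [standard]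
      cases hs : standard n r k with
      | nil => rw [hs] at h; cases h
      | cons d m =>
        rw [hs] at h
        cases h with
        | cons h₁ h₂ => exact List.rel_append (Carries.children h₁) h₂

/-- The lists before and after `f` have equal length, so short swaps carry both to the same standard
list. Hence `f` is a quotient of two products of short swaps. -/
theorem closure_shortSwaps (hn : 2 ≤ n) :
    Subgroup.closure (shortSwaps n r) = higmanThompsonGroup n r := by
  apply le_antisymm
  · rw [Subgroup.closure_le]
    rintro f ⟨b, c, -, -, -, hf⟩
    exact hf.mem_higmanThompsonGroup
  · intro f hf
    obtain ⟨l, l', m, hl, hm, hc, hperm⟩ := exists_carries hn hf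
    obtain ⟨k, hk, h⟩ := hl.exists_carries_standard hn
    obtain ⟨k', hk', h'⟩ := hm.exists_carries_standard hn
    obtain ⟨g, hg, hgc⟩ := h l .rfl
    obtain ⟨g', hg', hgc'⟩ := h' l' hperm
    have hlen : l.length = m.length := (List.Forall₂.length_eq hc).trans hperm.length_eq
    have : k = k' := by
      rw [hk, hk', Nat.add_left_cancel_iff] at hlen
      exact Nat.eq_of_mul_eq_mul_right (by omega) hlen
    subst this
    have := (hgc'.mul hc).eq hgc hl
    rw [eq_inv_mul_of_mul_eq this]
    exact mul_mem (inv_mem hg') hg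

end HigmanThompson

/-! ## Generators of Thompson's groups -/

namespace HigmanThompson

theorem exists_eq_cons {α : Type*} (s : Stream' α) : ∃ a t, s = Stream'.cons a t :=
  ⟨s.head, s.tail, (Stream'.eta s).symm⟩

theorem lexLT_cons {i j : Fin 1} {a b : Fin 2} {s t : Stream' (Fin 2)} :
    LexLT (i, Stream'.cons a s) (j, Stream'.cons b t) ↔ a < b ∨ a = b ∧ LexLT (i, s) (j, t) := by
  constructor
  · rintro ⟨k, h₁, h₂⟩
    cases k with
    | zero => exact .inl h₂
    | succ k =>
      exact .inr ⟨h₁ 0 (Nat.succ_pos k), k, fun m hm => h₁ (m + 1) (Nat.succ_lt_succ hm), h₂⟩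
  · rintro (h | ⟨rfl, k, h₁, h₂⟩)
    · exact ⟨0, fun m hm => absurd hm (Nat.not_lt_zero m), h⟩
    · refine ⟨k + 1, fun m hm => ?_, h₂⟩
      cases m with
      | zero => rfl
      | succ m => exact h₁ m (Nat.lt_of_succ_lt_succ hm)

theorem LexLT.asymm {p q : Point 2 1} (h : LexLT p q) : ¬ LexLT q p := by
  rintro ⟨m, h₁, h₂⟩
  obtain ⟨k, h₃, h₄⟩ := h
  rcases lt_trichotomy k m with hk | rfl | hk
  · exact h₄.ne (h₁ k hk).symm
  · exact h₄.asymm h₂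
  · exact h₂.ne (h₃ m hk).symm

theorem lexLT_extend {b : Word 2 1} {s t : Stream' (Fin 2)} :
    LexLT (extend b s) (extend b t) ↔ LexLT (0, s) (0, t) := by
  obtain ⟨i, l⟩ := b
  obtain rfl : i = 0 := Subsingleton.elim _ _
  induction l with
  | nil => rfl
  | cons a l ih =>
    change LexLT (0, Stream'.cons a (l ++ₛ s)) (0, Stream'.cons a (l ++ₛ t)) ↔ _
    rw [lexLT_cons, ← ih]
    simp [extend]

/-- All points with prefix `b` are less than those with prefix `c`. -/
def WordLT (b c : Word 2 1) : Prop := ∀ s t, LexLT (extend b s) (extend c t)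

theorem IsSubdivision.pairwise_wordLT {l : List (Word 2 1)} (hl : IsSubdivision l) :
    l.Pairwise WordLT := by
  refine hl.pairwise ?_ ?_ ?_ ?_
  · intro i j hij
    exact (hij.ne (Subsingleton.elim _ _)).elim
  · intro b i j hij s t
    rw [← extend_extend, ← extend_extend, lexLT_extend]
    exact lexLT_cons.2 (.inl hij)
  · intro b c i h s t
    rw [← extend_extend]
    exact h _ _
  · intro b c i h s t
    rw [← extend_extend]
    exact h _ _

theorem Carries.pairwise_wordLT {f : Equiv.Perm (Point 2 1)} (hf : f ∈ thompsonF)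
    {l l' : List (Word 2 1)} (h : Carries f l l') (hl : l.Pairwise WordLT) :
    l'.Pairwise WordLT := by
  unfold Carries at h
  induction h with
  | nil => exact .nil
  | @cons b c l l' hbc h ih =>
    rw [List.pairwise_cons] at hl ⊢
    refine ⟨fun c' hc' s t => ?_, ih hl.2⟩
    obtain ⟨b', hb', hbc'⟩ : ∃ b' ∈ l, ∀ s, f (extend b' s) = extend c' s := by
      clear ih hl
      induction h with
      | nil => simp at hc'
      | cons h₁ _ ih =>
        rcases List.mem_cons.1 hc' with rfl | hc'
        · exact ⟨_, List.mem_cons_self, h₁⟩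
        · obtain ⟨b', hb', h₂⟩ := ih hc'
          exact ⟨b', List.mem_cons_of_mem _ hb', h₂⟩
    rw [← hbc, ← hbc', hf.2]
    exact hl.1 b' hb' s t

/-! ### Vines and rotations. -/

/-- The words `0, 10, 110, ...` and `11...1`, in order, each preceded by `k` letters `1`. -/
def vine (k : ℕ) : ℕ → List (Word 2 1)
  | 0 => [(0, List.replicate k 1)]
  | m + 1 => (0, List.replicate k 1 ++ [0]) :: vine (k + 1) m

theorem length_vine (k m : ℕ) : (vine k m).length = m + 1 := by
  induction m generalizing k with
  | zero => rfl
  | succ m ih => rw [vine, List.length_cons, ih]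

/-- The permutation `f` is a rotation at the word `11...1` of length `k`. -/
structure IsRotation (k : ℕ) (f : Equiv.Perm (Point 2 1)) : Prop where
  fixed : ∀ j < k, ∀ s, f (extend (0, List.replicate j 1 ++ [0]) s) =
    extend (0, List.replicate j 1 ++ [0]) s
  left : ∀ s, f (extend (0, List.replicate k 1 ++ [0, 0]) s) =
    extend (0, List.replicate k 1 ++ [0]) s
  middle : ∀ s, f (extend (0, List.replicate k 1 ++ [0, 1]) s) =
    extend (0, List.replicate k 1 ++ [1, 0]) s
  right : ∀ s, f (extend (0, List.replicate k 1 ++ [1]) s) =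
    extend (0, List.replicate k 1 ++ [1, 1]) s

/-- Conjugation by a rotation at the empty word shifts the rotations at other words. -/
theorem IsRotation.conj {k : ℕ} {f g : Equiv.Perm (Point 2 1)} (hf : IsRotation 0 f)
    (hg : IsRotation (k + 1) g) : IsRotation (k + 2) (f * g * f⁻¹) := by
  have hinv {p q} (h : f p = q) : f⁻¹ q = p := by rw [Equiv.Perm.inv_eq_iff_eq, h]
  have hone (l : List (Fin 2)) (s) : f (extend (0, 1 :: l) s) = extend (0, 1 :: 1 :: l) s := by
    have := hf.right (l ++ₛ s)
    rw [extend_extend, extend_extend] at this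
    exact this
  have key {l l' : List (Fin 2)} (h : ∀ s, g (extend (0, 1 :: l) s) = extend (0, 1 :: l') s) (s) :
      (f * g * f⁻¹) (extend (0, 1 :: 1 :: l) s) = extend (0, 1 :: 1 :: l') s := by
    rw [Equiv.Perm.mul_apply, Equiv.Perm.mul_apply, hinv (hone l s), h, hone]
  refine ⟨fun j hj s => ?_, key hg.left, key hg.middle, key hg.right⟩
  -- The rotation `f` takes the cones of `00` and `01` to those of `0` and `10`. Both lie in the
  -- cone of `0`, which `g` fixes, so the conjugate fixes their images. For larger `j` the words
  -- begin with `11`.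
  obtain _ | _ | j := j
  · have h₀ : g (extend (0, [0, 0]) s) = extend (0, [0, 0]) s := by
      have := hg.fixed 0 (Nat.succ_pos k) ([0] ++ₛ s)
      rwa [extend_extend] at this
    have h₁ := hf.left s
    simp only [List.replicate_zero, List.nil_append] at h₁ ⊢
    rw [Equiv.Perm.mul_apply, Equiv.Perm.mul_apply, hinv h₁, h₀, h₁]
  · have h₀ : g (extend (0, [0, 1]) s) = extend (0, [0, 1]) s := by
      have := hg.fixed 0 (Nat.succ_pos k) ([1] ++ₛ s)
      rwa [extend_extend] at this
    have h₁ := hf.middle s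
    simp only [List.replicate_zero, List.nil_append] at h₁
    change (f * g * f⁻¹) (extend (0, [1, 0]) s) = extend (0, [1, 0]) s
    rw [Equiv.Perm.mul_apply, Equiv.Perm.mul_apply, hinv h₁, h₀, h₁]
  · have h₀ := hg.fixed (j + 1) (by omega)
    simp only [List.replicate_succ, List.cons_append] at h₀ ⊢
    exact key h₀ s

theorem exists_isRotation {f g : Equiv.Perm (Point 2 1)} (hf : IsRotation 0 f)
    (hg : IsRotation 1 g) (k : ℕ) : ∃ h ∈ Subgroup.closure {f, g}, IsRotation k h := by
  have hfm : f ∈ Subgroup.closure {f, g} := Subgroup.subset_closure (.inl rfl)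
  have hgm : g ∈ Subgroup.closure {f, g} := Subgroup.subset_closure (.inr rfl)
  obtain _ | k := k
  · exact ⟨f, hfm, hf⟩
  induction k with
  | zero => exact ⟨g, hgm, hg⟩
  | succ k ih =>
    obtain ⟨h, hh, hk⟩ := ih
    exact ⟨f * h * f⁻¹, mul_mem (mul_mem hfm hh) (inv_mem hfm), hf.conj hk⟩

theorem carries_vine {f : Equiv.Perm (Point 2 1)} {i j : ℕ}
    (hf : ∀ s, f (extend (0, List.replicate i 1) s) = extend (0, List.replicate j 1) s) (m : ℕ) :
    Carries f (vine i m) (vine j m) := by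
  induction m generalizing i j with
  | zero => exact .cons hf .nil
  | succ m ih =>
    refine .cons (fun s => by rw [← extend_extend, hf, extend_extend]) (ih fun s => ?_)
    rw [List.replicate_succ', List.replicate_succ', ← extend_extend, hf, extend_extend]

theorem children_eq (b : Word 2 1) : children b = [(b.1, b.2 ++ [0]), (b.1, b.2 ++ [1])] := rfl

/-- Expanding the last word of a vine gives a vine. After expansion of an earlier word `1…10`, the
rotation at `1…1` moves the new branching onto the spine and fixes all earlier words; this last fact
is carried along for the induction. -/
theorem exists_carries_vine_succ {f g : Equiv.Perm (Point 2 1)} (hf : IsRotation 0 f)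
    (hg : IsRotation 1 g) {m k : ℕ} {l₁ l₂ : List (Word 2 1)} {b : Word 2 1}
    (h : vine k m = l₁ ++ b :: l₂) : ∃ h ∈ Subgroup.closure {f, g},
      Carries h (l₁ ++ (children b ++ l₂)) (vine k (m + 1)) ∧
      ∀ j < k, ∀ s, h (extend (0, List.replicate j 1 ++ [0]) s) =
        extend (0, List.replicate j 1 ++ [0]) s := by
  induction l₁ generalizing k m with
  | nil =>
    cases m with
    | zero =>
      simp only [vine, List.nil_append, List.cons.injEq] at h
      obtain ⟨rfl, rfl⟩ := h
      refine ⟨1, one_mem _, ?_, fun _ _ _ => rfl⟩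
      have : vine k (0 + 1) = [] ++ (children (0, List.replicate k 1) ++ []) := by
        simp [children_eq, vine, List.replicate_succ']
      rw [this]
      exact .one _
    | succ m =>
      simp only [vine, List.nil_append, List.cons.injEq] at h
      obtain ⟨rfl, rfl⟩ := h
      obtain ⟨h, hh, hk⟩ := exists_isRotation hf hg k
      refine ⟨h, hh, ?_, hk.fixed⟩
      rw [children_eq]
      refine .cons ?_ (.cons ?_ ?_)
      · simpa using hk.left
      · simpa [List.replicate_succ'] using hk.middle
      · refine carries_vine ?_ m
        simpa [List.replicate_succ'] using hk.right
  | cons d l₁ ih =>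
    cases m with
    | zero => simp [vine] at h
    | succ m =>
      simp only [vine, List.cons_append, List.cons.injEq] at h
      obtain ⟨rfl, h⟩ := h
      obtain ⟨h', hh, h₁, h₂⟩ := ih h
      exact ⟨h', hh, .cons (h₂ k (Nat.lt_succ_self k)) h₁, fun j hj => h₂ j (by omega)⟩

theorem Carries.exists_eq_append {f : Equiv.Perm (Point 2 1)} {l₁ l₂ l : List (Word 2 1)}
    {b : Word 2 1} (h : Carries f (l₁ ++ b :: l₂) l) : ∃ m₁ c m₂, l = m₁ ++ c :: m₂ ∧
      Carries f l₁ m₁ ∧ (∀ s, f (extend b s) = extend c s) ∧ Carries f l₂ m₂ := by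
  induction l₁ generalizing l with
  | nil =>
    cases h with
    | cons h₁ h₂ => exact ⟨[], _, _, rfl, .nil, h₁, h₂⟩
  | cons d l₁ ih =>
    cases h with
    | cons h₁ h₂ =>
      obtain ⟨m₁, c, m₂, rfl, h₃, h₄, h₅⟩ := ih h₂
      exact ⟨_ :: m₁, c, m₂, rfl, .cons h₁ h₃, h₄, h₅⟩

theorem IsSubdivision.exists_carries_vine {f g : Equiv.Perm (Point 2 1)} (hf : IsRotation 0 f)
    (hg : IsRotation 1 g) {l : List (Word 2 1)} (hl : IsSubdivision l) :
    ∃ m, ∃ h ∈ Subgroup.closure {f, g}, Carries h l (vine 0 m) := by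
  induction hl with
  | roots => exact ⟨0, 1, one_mem _, .one _⟩
  | @expand l₁ b l₂ _ ih =>
    obtain ⟨m, h, hh, hc⟩ := ih
    obtain ⟨m₁, c, m₂, hm, h₁, h₂, h₃⟩ := hc.exists_eq_append
    obtain ⟨u, hu, huc, -⟩ := exists_carries_vine_succ hf hg hm
    exact ⟨m + 1, u * h, mul_mem hu hh,
      huc.mul (List.rel_append h₁ (List.rel_append (Carries.children h₂) h₃))⟩

/-- Two rotations generate Thompson's group `F`. -/
theorem closure_eq_thompsonF {f g : Equiv.Perm (Point 2 1)} (hf : IsRotation 0 f)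
    (hg : IsRotation 1 g) (hf' : f ∈ thompsonF) (hg' : g ∈ thompsonF) :
    Subgroup.closure {f, g} = thompsonF := by
  apply le_antisymm
  · rw [Subgroup.closure_le]
    rintro h (rfl | rfl)
    exacts [hf', hg']
  · intro h hh
    obtain ⟨l, l', m, hl, hm, hc, hperm⟩ := exists_carries le_rfl hh.1
    -- Both lists are sorted in the same order and contain the same words.
    obtain rfl : l' = m := by
      refine hperm.eq_of_pairwise ?_ (hc.pairwise_wordLT hh hl.pairwise_wordLT) hm.pairwise_wordLT
      intro b c _ _ h₁ h₂
      exact ((h₁ (Stream'.const 0) (Stream'.const 0)).asymm (h₂ _ _)).elim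
    obtain ⟨k, u, hu, huc⟩ := hl.exists_carries_vine hf hg
    obtain ⟨k', v, hv, hvc⟩ := hm.exists_carries_vine hf hg
    have h₁ := List.Forall₂.length_eq huc
    have h₂ := List.Forall₂.length_eq hvc
    have h₃ := List.Forall₂.length_eq hc
    rw [length_vine] at h₁ h₂
    obtain rfl : k = k' := by omega
    rw [eq_inv_mul_of_mul_eq ((hvc.mul hc).eq huc hl)]
    exact mul_mem (inv_mem hv) hu

/-! ### Explicit rotations. -/

/-- The rotation `00s ↦ 0s`, `01s ↦ 10s`, `1s ↦ 11s`. -/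
def rotation : Equiv.Perm (Stream' (Fin 2)) where
  toFun s :=
    if s.head = 0 then
      if s.tail.head = 0 then Stream'.cons 0 s.tail.tail
      else Stream'.cons 1 (Stream'.cons 0 s.tail.tail)
    else Stream'.cons 1 (Stream'.cons 1 s.tail)
  invFun s :=
    if s.head = 0 then Stream'.cons 0 (Stream'.cons 0 s.tail)
    else if s.tail.head = 0 then Stream'.cons 0 (Stream'.cons 1 s.tail.tail)
    else Stream'.cons 1 s.tail.tail
  left_inv s := by
    obtain ⟨a, s, rfl⟩ := exists_eq_cons s
    obtain ⟨b, s, rfl⟩ := exists_eq_cons s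
    fin_cases a <;> fin_cases b <;> simp
  right_inv s := by
    obtain ⟨a, s, rfl⟩ := exists_eq_cons s
    obtain ⟨b, s, rfl⟩ := exists_eq_cons s
    fin_cases a <;> fin_cases b <;> simp

/-- The permutation that acts as `f` on the tails of the strings with first letter `1`. -/
def onTails (f : Equiv.Perm (Stream' (Fin 2))) : Equiv.Perm (Stream' (Fin 2)) where
  toFun s := if s.head = 0 then s else Stream'.cons 1 (f s.tail)
  invFun s := if s.head = 0 then s else Stream'.cons 1 (f.symm s.tail)
  left_inv s := by
    obtain ⟨a, s, rfl⟩ := exists_eq_cons s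
    fin_cases a <;> simp
  right_inv s := by
    obtain ⟨a, s, rfl⟩ := exists_eq_cons s
    fin_cases a <;> simp

/-- The permutation of the set of points that comes from a permutation of infinite strings. -/
def onPoints (f : Equiv.Perm (Stream' (Fin 2))) : Equiv.Perm (Point 2 1) :=
  (Equiv.refl (Fin 1)).prodCongr f

theorem rotation_zero_zero (s : Stream' (Fin 2)) :
    rotation (Stream'.cons 0 (Stream'.cons 0 s)) = Stream'.cons 0 s := rfl

theorem rotation_zero_one (s : Stream' (Fin 2)) :
    rotation (Stream'.cons 0 (Stream'.cons 1 s)) = Stream'.cons 1 (Stream'.cons 0 s) := rfl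

theorem rotation_one (s : Stream' (Fin 2)) :
    rotation (Stream'.cons 1 s) = Stream'.cons 1 (Stream'.cons 1 s) := rfl

theorem onTails_zero (f : Equiv.Perm (Stream' (Fin 2))) (s : Stream' (Fin 2)) :
    onTails f (Stream'.cons 0 s) = Stream'.cons 0 s := rfl

theorem onTails_one (f : Equiv.Perm (Stream' (Fin 2))) (s : Stream' (Fin 2)) :
    onTails f (Stream'.cons 1 s) = Stream'.cons 1 (f s) := rfl

theorem isRotation_rotation : IsRotation 0 (onPoints rotation) :=
  ⟨fun _ h => absurd h (Nat.not_lt_zero _), fun _ => rfl, fun _ => rfl, fun _ => rfl⟩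

theorem isRotation_onTails_rotation : IsRotation 1 (onPoints (onTails rotation)) := by
  refine ⟨fun j h s => ?_, fun _ => rfl, fun _ => rfl, fun _ => rfl⟩
  obtain rfl : j = 0 := by omega
  rfl

theorem lexLT_rotation (s t : Stream' (Fin 2)) (i j : Fin 1) :
    LexLT (i, rotation s) (j, rotation t) ↔ LexLT (i, s) (j, t) := by
  obtain ⟨a, s, rfl⟩ := exists_eq_cons s
  obtain ⟨b, s, rfl⟩ := exists_eq_cons s
  obtain ⟨c, t, rfl⟩ := exists_eq_cons t
  obtain ⟨d, t, rfl⟩ := exists_eq_cons t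
  fin_cases a <;> fin_cases b <;> fin_cases c <;> fin_cases d <;>
    simp [rotation_zero_zero, rotation_zero_one, rotation_one, lexLT_cons]

theorem rotation_mem_thompsonF : onPoints rotation ∈ thompsonF := by
  refine ⟨(isPrefixReplacement_iff _).2 ⟨2, two_pos, ?_⟩, fun p q => lexLT_rotation _ _ _ _⟩
  rintro ⟨i, l⟩ hl
  obtain ⟨a, b, rfl⟩ := List.length_eq_two.1 hl
  fin_cases a <;> fin_cases b
  exacts [⟨(i, [0]), fun s => rfl⟩, ⟨(i, [1, 0]), fun s => rfl⟩, ⟨(i, [1, 1, 0]), fun s => rfl⟩,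
    ⟨(i, [1, 1, 1]), fun s => rfl⟩]

theorem onTails_rotation_mem_thompsonF : onPoints (onTails rotation) ∈ thompsonF := by
  refine ⟨(isPrefixReplacement_iff _).2 ⟨3, three_pos, ?_⟩, ?_⟩
  · rintro ⟨i, l⟩ hl
    obtain ⟨a, b, c, rfl⟩ := List.length_eq_three.1 hl
    fin_cases a
    · exact ⟨(i, [0, b, c]), fun s => rfl⟩
    · fin_cases b <;> fin_cases c
      exacts [⟨(i, [1, 0]), fun s => rfl⟩, ⟨(i, [1, 1, 0]), fun s => rfl⟩,
        ⟨(i, [1, 1, 1, 0]), fun s => rfl⟩, ⟨(i, [1, 1, 1, 1]), fun s => rfl⟩]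
  · rintro ⟨i, s⟩ ⟨j, t⟩
    change LexLT (i, onTails rotation s) (j, onTails rotation t) ↔ _
    obtain ⟨a, s, rfl⟩ := exists_eq_cons s
    obtain ⟨b, t, rfl⟩ := exists_eq_cons t
    fin_cases a <;> fin_cases b <;>
      simp [onTails_zero, onTails_one, lexLT_rotation, lexLT_cons]

/-! ### Generators of `T`. -/

theorem thompsonF_le_thompsonT : thompsonF ≤ thompsonT :=
  fun _ hf => ⟨hf.1, fun p q t => by simp only [CyclicLT, hf.2]⟩

/-- The least point. -/
def zeroPoint : Point 2 1 := (0, Stream'.const 0)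

theorem zeroPoint_lexLT {p : Point 2 1} (hp : p ≠ zeroPoint) : LexLT zeroPoint p := by
  obtain ⟨i, s⟩ := p
  have hs : ∃ k, s.get k ≠ 0 := by
    by_contra! h
    exact hp (Prod.ext (Subsingleton.elim _ _) (Stream'.ext h))
  classical
  refine ⟨Nat.find hs, fun j hj => ?_, ?_⟩
  · exact (not_not.1 (Nat.find_min hs hj)).symm
  · exact Fin.pos_of_ne_zero (Nat.find_spec hs)

theorem not_lexLT_zeroPoint (p : Point 2 1) : ¬ LexLT p zeroPoint := by
  rintro ⟨k, -, h⟩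
  exact absurd h (Fin.not_lt_zero _)

/-- Cutting the cyclic order at the least point gives back the linear order: for `p` above it,
`LexLT p q` is `CyclicLT zeroPoint p q`. -/
theorem mem_thompsonF_of_fixes {f : Equiv.Perm (Point 2 1)} (hf : f ∈ thompsonT)
    (h₀ : f zeroPoint = zeroPoint) : f ∈ thompsonF := by
  refine ⟨hf.1, fun p q => ?_⟩
  have key (p q : Point 2 1) : CyclicLT zeroPoint p q ↔ LexLT zeroPoint p ∧ LexLT p q := by
    simp only [CyclicLT, not_lexLT_zeroPoint]
    tauto
  have hz (p : Point 2 1) : LexLT zeroPoint p ↔ p ≠ zeroPoint :=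
    ⟨fun h e => not_lexLT_zeroPoint p (by rwa [e] at h ⊢), zeroPoint_lexLT⟩
  have hfz (p : Point 2 1) : f p ≠ zeroPoint ↔ p ≠ zeroPoint := by
    rw [← f.injective.ne_iff (x := p), h₀]
  by_cases hp : p = zeroPoint
  · rw [hp, h₀, hz, hz, hfz]
  · have h := hf.2 zeroPoint p q
    rw [h₀, key, key, hz, hz, hfz] at h
    tauto

theorem IsConeSwap.mem_thompsonT {f : Equiv.Perm (Point 2 1)}
    (hf : IsConeSwap f (0, [0]) (0, [1])) : f ∈ thompsonT := by
  have h₀ (i : Fin 1) (s) : f (i, Stream'.cons 0 s) = (i, Stream'.cons 1 s) := by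
    obtain rfl : i = 0 := Subsingleton.elim _ _
    exact hf.left s
  have h₁ (i : Fin 1) (s) : f (i, Stream'.cons 1 s) = (i, Stream'.cons 0 s) := by
    obtain rfl : i = 0 := Subsingleton.elim _ _
    exact hf.right s
  refine ⟨hf.mem_higmanThompsonGroup, ?_⟩
  rintro ⟨i, s⟩ ⟨j, t⟩ ⟨k, u⟩
  obtain ⟨a, s, rfl⟩ := exists_eq_cons s
  obtain ⟨b, t, rfl⟩ := exists_eq_cons t
  obtain ⟨c, u, rfl⟩ := exists_eq_cons u
  fin_cases a <;> fin_cases b <;> fin_cases c <;>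
    simp [h₀, h₁, CyclicLT, lexLT_cons]

/-- Induction on the length of `l`. The swap makes the first letter `0`. Then the rotation shortens
`00…` to `0…`, while the swap followed by the inverse rotation turns `01…` into `11…` and then `1…`.
-/
theorem exists_apply_eq_zeroPoint {f h : Equiv.Perm (Point 2 1)} (hf : IsRotation 0 f)
    (hh : IsConeSwap h (0, [0]) (0, [1])) {H : Subgroup (Equiv.Perm (Point 2 1))} (hfH : f ∈ H)
    (hhH : h ∈ H) (l : List (Fin 2)) :
    ∃ g ∈ H, g (extend (0, l) (Stream'.const 0)) = zeroPoint := by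
  induction hk : l.length using Nat.strong_induction_on generalizing l with
  | _ k ih =>
  subst hk
  have hzero : extend ((0 : Fin 1), [(0 : Fin 2)]) (Stream'.const 0) = zeroPoint := by
    simp only [extend, zeroPoint, Prod.mk.injEq, true_and]
    exact (Stream'.const_eq 0).symm
  have hstep {g : Equiv.Perm (Point 2 1)} (hg : g ∈ H) {l l' : List (Fin 2)}
      (hl : ∃ u ∈ H, u (extend (0, l') (Stream'.const 0)) = zeroPoint)
      (h : ∀ s, g (extend (0, l) s) = extend (0, l') s) :
      ∃ u ∈ H, u (extend (0, l) (Stream'.const 0)) = zeroPoint := by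
    obtain ⟨u, hu, hul⟩ := hl
    exact ⟨u * g, mul_mem hu hg, by rw [Equiv.Perm.mul_apply, h, hul]⟩
  have hinv : ∀ (l : List (Fin 2)) s,
      f⁻¹ (extend (0, 1 :: 1 :: l) s) = extend (0, 1 :: l) s := by
    intro l s
    rw [Equiv.Perm.inv_eq_iff_eq]
    exact (hf.right (l ++ₛ s)).symm
  have hswap₀ (l : List (Fin 2)) (s) : h (extend (0, 0 :: l) s) = extend (0, 1 :: l) s :=
    hh.left (l ++ₛ s)
  have hswap₁ (l : List (Fin 2)) (s) : h (extend (0, 1 :: l) s) = extend (0, 0 :: l) s :=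
    hh.right (l ++ₛ s)
  have hcase (l' : List (Fin 2)) (hl' : l'.length + 1 = l.length) :
      ∃ u ∈ H, u (extend (0, 0 :: l') (Stream'.const 0)) = zeroPoint := by
    rcases l' with _ | ⟨a, l'⟩
    · exact ⟨1, one_mem H, hzero⟩
    · simp only [List.length_cons] at hl'
      fin_cases a
      · exact hstep hfH (ih _ (by simp; omega) (0 :: l') rfl) fun s => hf.left (l' ++ₛ s)
      · exact hstep hhH (hstep (inv_mem hfH) (ih _ (by simp; omega) (1 :: l') rfl) (hinv l'))
          (hswap₀ _)
  rcases l with _ | ⟨a, l⟩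
  · exact ⟨1, one_mem H, rfl⟩
  · fin_cases a
    · exact hcase l rfl
    · exact hstep hhH (hcase l rfl) (hswap₁ l)

/-- Two rotations and a swap generate Thompson's group `T`. -/
theorem closure_eq_thompsonT {f g h : Equiv.Perm (Point 2 1)} (hf : IsRotation 0 f)
    (hg : IsRotation 1 g) (hf' : f ∈ thompsonF) (hg' : g ∈ thompsonF)
    (hh : IsConeSwap h (0, [0]) (0, [1])) : Subgroup.closure {h, f, g} = thompsonT := by
  apply le_antisymm
  · rw [Subgroup.closure_le]
    rintro u (rfl | rfl | rfl)
    exacts [hh.mem_thompsonT, thompsonF_le_thompsonT hf', thompsonF_le_thompsonT hg']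
  · intro u hu
    have hF : thompsonF ≤ Subgroup.closure {h, f, g} := by
      rw [← closure_eq_thompsonF hf hg hf' hg']
      exact Subgroup.closure_mono (Set.subset_insert _ _)
    have hhm : h ∈ Subgroup.closure {h, f, g} := Subgroup.subset_closure (.inl rfl)
    obtain ⟨N, -, hN⟩ := (isPrefixReplacement_iff u).1 hu.1
    -- The image of the least point also ends in zeros, so some `v` generated by `h` and `f` takes
    -- it back. The product `v * u` then fixes the least point and lies in `F`.
    obtain ⟨⟨i, l⟩, hl⟩ := hN (0, zeroPoint.2.take N) (by simp)
    obtain rfl : i = 0 := Subsingleton.elim _ _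
    have hz : extend (0, zeroPoint.2.take N) (Stream'.const 0) = zeroPoint :=
      extend_take_drop zeroPoint N
    have hT : Subgroup.closure {h, f, g} ≤ thompsonT := by
      rw [Subgroup.closure_le]
      rintro u (rfl | rfl | rfl)
      exacts [hh.mem_thompsonT, thompsonF_le_thompsonT hf', thompsonF_le_thompsonT hg']
    obtain ⟨v, hv, hvz⟩ := exists_apply_eq_zeroPoint hf hh (hF hf') hhm l
    have hmem := mem_thompsonF_of_fixes (mul_mem (hT hv) hu)
      (by rw [Equiv.Perm.mul_apply, ← hz, hl, hvz, hz])
    have := mul_mem (inv_mem hv) (hF hmem)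
    rwa [inv_mul_cancel_left] at this

end HigmanThompson

/-! ### The main theorem. -/

theorem mainTheorem3 :
    (∀ n r : ℕ, 2 ≤ n → 1 ≤ r → IsSpecialCoET0L (higmanThompsonGroup n r)) ∧
      IsSpecialCoET0L thompsonF ∧ IsSpecialCoET0L thompsonT := by
  refine ⟨fun n r hn _ => ?_, ?_, ?_⟩
  · exact isSpecialCoET0L_of_closure hn le_rfl (finite_shortSwaps n r) (closure_shortSwaps hn)
  · exact isSpecialCoET0L_of_closure le_rfl (fun _ hf => hf.1) (Set.toFinite _)
      (closure_eq_thompsonF isRotation_rotation isRotation_onTails_rotation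
        rotation_mem_thompsonF onTails_rotation_mem_thompsonF)
  · obtain ⟨h, hh⟩ := exists_isConeSwap (b := ((0 : Fin 1), [(0 : Fin 2)])) (c := (0, [1]))
      (by simp [Incomparable])
    exact isSpecialCoET0L_of_closure le_rfl (fun _ hf => hf.1) (Set.toFinite _)
      (closure_eq_thompsonT isRotation_rotation isRotation_onTails_rotation
        rotation_mem_thompsonF onTails_rotation_mem_thompsonF hh)
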